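/- Let $\Gamma$ be Euler's Gamma function, $\zeta$ the Riemann zeta function, and $L(s)=L(s,\chi_4)$ the Dirichlet beta function, i.e. the entire continuation of $\sum_{n\ge 0}(-1)^n(2n+1)^{-s}$. Let $$A(s)=\frac{\Gamma(s)\,\zeta(s)\,L(s)}{\pi^{s}},$$ a meromorphic function on $\mathbb{C}$. For $T>0$ let $N_A(T)$ and $N_L(T)$ be the number of zeros $s=\sigma+it$, counted with multiplicity, of $A$ and of $L$ respectively in the rectangle $0\le\sigma\le 1$, $0\le t\le T$ of the critical strip (so that $N_L(T)$ counts the nontrivial zeros of $L$). Both numbers are finite, and as $T\to\infty$ $$N_A(T)=\frac{T}{\pi}\log\frac{T}{\pi e}+O(\log T),\qquad N_L(T)=\frac{T}{2\pi}\log\frac{2T}{\pi e}+O(\log T).$$ -/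

import Mathlib

/-- The Dirichlet beta function `L(s) = L(s, χ₄)`: the entire continuation of
`∑ (-1)^n / (2n+1)^s`, where `χ₄` is the nontrivial Dirichlet character modulo `4`. -/
noncomputable def dirichletBeta (s : ℂ) : ℂ :=
  DirichletCharacter.LFunction (ZMod.χ₄.ringHomComp (Int.castRingHom ℂ)) s

/-- The function `A(s) = Γ(s) ζ(s) L(s) / π^s`, meromorphic on `ℂ`. -/
noncomputable def functionA (s : ℂ) : ℂ :=
  Complex.Gamma s * riemannZeta s * dirichletBeta s / (Real.pi : ℂ) ^ s

/-- The multiplicity of `z` as a zero of the meromorphic function `f`: the order of `f` at `z` if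
this is positive, and `0` otherwise. It does not depend on the value that the Lean function `f`
takes at the point `z` itself, so poles and removable singularities are treated correctly. -/
noncomputable def zeroMultiplicity (f : ℂ → ℂ) (z : ℂ) : ℕ :=
  (meromorphicOrderAt f z).untop₀.toNat

/-- The closed rectangle `0 ≤ σ ≤ 1`, `0 ≤ t ≤ T` in the critical strip, with `s = σ + i t`. -/
def criticalRectangle (T : ℝ) : Set ℂ :=
  {s | 0 ≤ s.re ∧ s.re ≤ 1 ∧ 0 ≤ s.im ∧ s.im ≤ T}

/-- The number of zeros of `f` in the rectangle `0 ≤ σ ≤ 1`, `0 ≤ t ≤ T`,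
counted with multiplicity. -/
noncomputable def zeroCount (f : ℂ → ℂ) (T : ℝ) : ℕ :=
  ∑ᶠ s ∈ criticalRectangle T, zeroMultiplicity f s

open Complex Set Filter Topology

/-! Both counts are instances of one Riemann–von Mangoldt formula, `IsCompletion.zeroCount_isBigO`,
for Λ(s) = exp(es) Γ(αs+β) f(s) with a symmetry s ↦ 1 - conj s, where f has polynomial growth and no
zeros in re s > 1. For A one takes f = ζL, e = -log π, α = 1, β = 0; for L one takes f = L, e = ½
log(4/π), α = β = ½. The symmetry comes from the functional equations of ζ and of L for a primitive
character mod 4: a factor 2^s absorbs the conductor, and the duplication formula merges the two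
Gamma factors of A into one.

The argument principle (`rectIntegral_logDeriv`) on [-1,2] × [t₀,T], folded along re s = ½ by the
symmetry, makes π times the number of zeros equal to the variation of arg Λ along the path ½+it₀,
2+it₀, 2+iT, ½+iT. The exponential and Γ depend only on the endpoints of the path; Stirling's
formula (`abs_re_integral_digamma_sub_le`) turns their share into T(e + α log(αT) - α) + O(1). On re
s = 2 the Dirichlet series are close to 1, so arg f varies boundedly
(`abs_re_integral_logDeriv_le`). On the top side Backlund's bound (`abs_im_integral_logDeriv_le`),
fed with the polynomial growth from partial summation (`norm_le_of_norm_sum_sub_le`), gives O(log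
T). Everything at or below the fixed height t₀ is a constant, and a height T that meets a zero is
approached from above.

Stirling's formula is derived from Euler's limit for Γ: the n-th approximant has an explicit
argument, t log n minus a sum of arctangents, and that sum is compared with an integral. -/

/-! ### Zeros and factorisation of analytic functions. -/

theorem zeroMultiplicity_eq_divisor {f : ℂ → ℂ} {U : Set ℂ} (hf : AnalyticOnNhd ℂ f U) {u : ℂ}
    (hu : u ∈ U) : (zeroMultiplicity f u : ℤ) = MeromorphicOn.divisor f U u := by
  rw [MeromorphicOn.divisor_apply hf.meromorphicOn hu, zeroMultiplicity, Int.toNat_of_nonneg]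
  have := (hf u hu).meromorphicOrderAt_nonneg
  rcases h : meromorphicOrderAt f u with _ | n
  · exact le_rfl
  · rw [h] at this
    exact WithTop.coe_le_coe.mp this

/-- A function that is analytic and not identically zero on a compact connected set is there the
product of a polynomial and of an analytic function without zeros. -/
theorem AnalyticOnNhd.exists_eq_prod_mul {f : ℂ → ℂ} {U : Set ℂ} (hf : AnalyticOnNhd ℂ f U)
    (hU : IsCompact U) (hc : IsPreconnected U) (hnt : U.Nontrivial) {z₀ : ℂ} (hz₀ : z₀ ∈ U)
    (h₀ : f z₀ ≠ 0) :
    ∃ (S : Finset ℂ) (g : ℂ → ℂ), ↑S ⊆ U ∧ (∀ u ∈ U, u ∉ S → zeroMultiplicity f u = 0) ∧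
      (∀ u ∈ S, f u = 0) ∧
      AnalyticOnNhd ℂ g U ∧ (∀ z ∈ U, g z ≠ 0) ∧
      ∀ z ∈ U, f =ᶠ[𝓝 z] fun s => (∏ u ∈ S, (s - u) ^ zeroMultiplicity f u) * g s := by
  have hmer := hf.meromorphicOn
  have htop : ∀ u : U, meromorphicOrderAt f u ≠ ⊤ := by
    rw [← hmer.exists_meromorphicOrderAt_ne_top_iff_forall ⟨⟨z₀, hz₀⟩, hc⟩]
    refine ⟨⟨z₀, hz₀⟩, ?_⟩
    have : meromorphicOrderAt f z₀ = 0 :=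
      (hf z₀ hz₀).meromorphicNFAt.meromorphicOrderAt_eq_zero_iff.2 h₀
    simp [this]
  have hfin := (MeromorphicOn.divisor f U).finiteSupport hU
  obtain ⟨g, hg, hg0, hfg⟩ := hmer.extract_zeros_poles htop hfin
  have hS : ∀ u ∈ hfin.toFinset, u ∈ U := fun u hu => by
    by_contra h
    simp [h] at hu
  refine ⟨hfin.toFinset, g, hS, fun u hu hn => ?_, fun u hu => ?_, hg, fun z hz => hg0 ⟨z, hz⟩,
    fun z hz => ?_⟩
  · have := zeroMultiplicity_eq_divisor hf hu
    simp only [Finite.mem_toFinset, Function.mem_support, not_not] at hn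
    rw [hn] at this
    exact_mod_cast this
  · by_contra h
    have h0 : meromorphicOrderAt f u = 0 :=
      (hf u (hS u hu)).meromorphicNFAt.meromorphicOrderAt_eq_zero_iff.2 h
    simp only [Finite.mem_toFinset, Function.mem_support] at hu
    exact hu (by rw [MeromorphicOn.divisor_apply hmer (hS u (by simpa using hu)), h0]; rfl)
  · have hP : (∏ᶠ u, (· - u) ^ MeromorphicOn.divisor f U u) • g =
        fun s => (∏ u ∈ hfin.toFinset, (s - u) ^ zeroMultiplicity f u) * g s := by
      rw [finprod_eq_prod_of_mulSupport_subset (s := hfin.toFinset) _ (by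
        rw [Function.FactorizedRational.mulSupport]; simp)]
      ext s
      simp only [Pi.smul_apply', Finset.prod_apply, Pi.pow_apply, smul_eq_mul]
      congr 1
      refine Finset.prod_congr rfl fun u hu => ?_
      rw [← zeroMultiplicity_eq_divisor hf (hS u hu), zpow_natCast]
    rw [hP] at hfg
    -- The extracted factorisation holds only off a codiscrete subset of `U`. Every point of `U` is
    -- an accumulation point and both sides are analytic, so it extends to full neighbourhoods.
    have hacc : AccPt z (𝓟 U) := hc.preperfect_of_nontrivial hnt z hz
    have hgz := hg z hz
    have han : AnalyticAt ℂ
        (fun s => (∏ u ∈ hfin.toFinset, (s - u) ^ zeroMultiplicity f u) * g s) z := by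
      fun_prop
    have := (hf z hz).meromorphicAt.eventuallyEq_nhdsNE_of_eventuallyEq_codiscreteWithin
      han.meromorphicAt hz hacc hfg
    exact ((hf z hz).frequently_eq_iff_eventually_eq han).1 (Eventually.frequently this)

/-- Away from the zeros, the logarithmic derivative of a function factored into linear factors. -/
theorem logDeriv_eq_sum_add {ι : Type*} {f g : ℂ → ℂ} {S : Finset ι} {p : ι → ℂ} {n : ι → ℕ} {z : ℂ}
    (h : f =ᶠ[𝓝 z] fun s => (∏ i ∈ S, (s - p i) ^ n i) * g s) (hz : ∀ i ∈ S, z ≠ p i)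
    (hg : DifferentiableAt ℂ g z) (hg0 : g z ≠ 0) :
    logDeriv f z = ∑ i ∈ S, n i * (z - p i)⁻¹ + logDeriv g z := by
  have h1 : logDeriv f z = logDeriv (fun s => (∏ i ∈ S, (s - p i) ^ n i) * g s) z := by
    simp only [logDeriv_apply, h.deriv_eq, h.eq_of_nhds]
  have hne : ∀ i ∈ S, (z - p i) ^ n i ≠ 0 := fun i hi => pow_ne_zero _ (sub_ne_zero.2 (hz i hi))
  rw [h1, logDeriv_mul z (Finset.prod_ne_zero_iff.2 hne) hg0 (by fun_prop) hg,
    logDeriv_prod (f := fun i s => (s - p i) ^ n i) hne (fun i _ => by fun_prop)]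
  congr 1
  refine Finset.sum_congr rfl fun i hi => ?_
  rw [logDeriv_fun_pow (by fun_prop), logDeriv_apply]
  simp

/-! ### The argument principle on a rectangle. -/

/-- The closed rectangle `[a, b] × [c, d]` in the complex plane. -/
def closedRect (a b c d : ℝ) : Set ℂ := Icc a b ×ℂ Icc c d

/-- The boundary of the rectangle `[a, b] × [c, d]`. -/
def rectBoundary (a b c d : ℝ) : Set ℂ :=
  {z ∈ closedRect a b c d | z.re = a ∨ z.re = b ∨ z.im = c ∨ z.im = d}

/-- The integral of `F` along the positively oriented boundary of `[a, b] × [c, d]`. -/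
noncomputable def rectIntegral (F : ℂ → ℂ) (a b c d : ℝ) : ℂ :=
  (∫ x in a..b, F (x + c * I)) - (∫ x in a..b, F (x + d * I)) +
    I * (∫ y in c..d, F (b + y * I)) - I * (∫ y in c..d, F (a + y * I))

section rect

variable {a b c d : ℝ}

theorem mem_closedRect {z : ℂ} :
    z ∈ closedRect a b c d ↔ (a ≤ z.re ∧ z.re ≤ b) ∧ c ≤ z.im ∧ z.im ≤ d := Iff.rfl

theorem ContinuousOn.intervalIntegrable_horizontal {F : ℂ → ℂ} {y : ℝ} {s : Set ℂ} (hab : a ≤ b)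
    (hF : ContinuousOn F s) (h : ∀ x ∈ Icc a b, (x + y * I : ℂ) ∈ s) :
    IntervalIntegrable (fun x : ℝ => F (x + y * I)) MeasureTheory.volume a b := by
  apply ContinuousOn.intervalIntegrable
  rw [uIcc_of_le hab]
  exact hF.comp (by fun_prop) h

theorem ContinuousOn.intervalIntegrable_vertical {F : ℂ → ℂ} {x : ℝ} {s : Set ℂ} (hcd : c ≤ d)
    (hF : ContinuousOn F s) (h : ∀ y ∈ Icc c d, (x + y * I : ℂ) ∈ s) :
    IntervalIntegrable (fun y : ℝ => F (x + y * I)) MeasureTheory.volume c d := by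
  apply ContinuousOn.intervalIntegrable
  rw [uIcc_of_le hcd]
  exact hF.comp (by fun_prop) h

theorem rect_sides_subset (hab : a ≤ b) (hcd : c ≤ d) :
    (∀ x ∈ Icc a b, (x + c * I : ℂ) ∈ rectBoundary a b c d) ∧
    (∀ x ∈ Icc a b, (x + d * I : ℂ) ∈ rectBoundary a b c d) ∧
    (∀ y ∈ Icc c d, (b + y * I : ℂ) ∈ rectBoundary a b c d) ∧
    (∀ y ∈ Icc c d, (a + y * I : ℂ) ∈ rectBoundary a b c d) := by
  simp only [rectBoundary, mem_closedRect]
  refine ⟨?_, ?_, ?_, ?_⟩ <;> intro x hx <;> simp [hab, hcd, hx.1, hx.2]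

theorem rectIntegral_add {F G : ℂ → ℂ} (hab : a ≤ b) (hcd : c ≤ d)
    (hF : ContinuousOn F (rectBoundary a b c d)) (hG : ContinuousOn G (rectBoundary a b c d)) :
    rectIntegral (fun z => F z + G z) a b c d
      = rectIntegral F a b c d + rectIntegral G a b c d := by
  obtain ⟨h1, h2, h3, h4⟩ := rect_sides_subset hab hcd
  unfold rectIntegral
  rw [intervalIntegral.integral_add (hF.intervalIntegrable_horizontal hab h1)
      (hG.intervalIntegrable_horizontal hab h1),
    intervalIntegral.integral_add (hF.intervalIntegrable_horizontal hab h2)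
      (hG.intervalIntegrable_horizontal hab h2),
    intervalIntegral.integral_add (hF.intervalIntegrable_vertical hcd h3)
      (hG.intervalIntegrable_vertical hcd h3),
    intervalIntegral.integral_add (hF.intervalIntegrable_vertical hcd h4)
      (hG.intervalIntegrable_vertical hcd h4)]
  ring

theorem rectIntegral_const_mul (F : ℂ → ℂ) (k : ℂ) :
    rectIntegral (fun z => k * F z) a b c d = k * rectIntegral F a b c d := by
  simp only [rectIntegral, intervalIntegral.integral_const_mul]
  ring

theorem rectIntegral_sum {ι : Type*} {F : ι → ℂ → ℂ} (S : Finset ι) (hab : a ≤ b) (hcd : c ≤ d)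
    (hF : ∀ i ∈ S, ContinuousOn (F i) (rectBoundary a b c d)) :
    rectIntegral (fun z => ∑ i ∈ S, F i z) a b c d = ∑ i ∈ S, rectIntegral (F i) a b c d := by
  classical
  induction S using Finset.induction_on with
  | empty => simp [rectIntegral]
  | insert i S hi ih =>
    simp only [Finset.sum_insert hi]
    rw [rectIntegral_add hab hcd (hF i (by simp)), ih fun j hj => hF j (by simp [hj])]
    exact continuousOn_finsetSum _ fun j hj => hF j (by simp [hj])

theorem rectIntegral_congr {F G : ℂ → ℂ} (hab : a ≤ b) (hcd : c ≤ d)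
    (h : EqOn F G (rectBoundary a b c d)) :
    rectIntegral F a b c d = rectIntegral G a b c d := by
  obtain ⟨h1, h2, h3, h4⟩ := rect_sides_subset hab hcd
  unfold rectIntegral
  congr 1
  · congr 1
    · congr 1 <;> refine intervalIntegral.integral_congr fun x hx => ?_
      · exact h (h1 x (by rwa [uIcc_of_le hab] at hx))
      · exact h (h2 x (by rwa [uIcc_of_le hab] at hx))
    · congr 1
      refine intervalIntegral.integral_congr fun x hx => ?_
      exact h (h3 x (by rwa [uIcc_of_le hcd] at hx))
  · congr 1
    refine intervalIntegral.integral_congr fun x hx => ?_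
    exact h (h4 x (by rwa [uIcc_of_le hcd] at hx))

theorem rectIntegral_eq_zero {F : ℂ → ℂ} (hab : a ≤ b) (hcd : c ≤ d)
    (hF : DifferentiableOn ℂ F (closedRect a b c d)) : rectIntegral F a b c d = 0 := by
  have := Complex.integral_boundary_rect_eq_zero_of_differentiableOn F ⟨a, c⟩ ⟨b, d⟩
    (by rw [uIcc_of_le hab, uIcc_of_le hcd]; exact hF)
  simpa [rectIntegral] using this

theorem integral_horizontal_eq_sub {F G : ℂ → ℂ} {y : ℝ} (hab : a ≤ b)
    (h : ∀ x ∈ Icc a b, HasDerivAt G (F (x + y * I)) (x + y * I))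
    (hF : ContinuousOn F {z | z.im = y ∧ z.re ∈ Icc a b}) :
    ∫ x in a..b, F (x + y * I) = G (b + y * I) - G (a + y * I) := by
  refine intervalIntegral.integral_eq_sub_of_hasDerivAt (f := fun x : ℝ => G (x + y * I))
    (fun x hx => ?_) (hF.intervalIntegrable_horizontal hab fun x hx => by simpa using hx)
  rw [uIcc_of_le hab] at hx
  have h1 : HasDerivAt (fun x : ℝ => (x + y * I : ℂ)) 1 x := by
    simpa using (Complex.ofRealCLM.hasDerivAt (x := x)).add_const (y * I)
  simpa [Function.comp_def] using (h x hx).comp x h1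

theorem integral_vertical_eq_sub {F G : ℂ → ℂ} {x : ℝ} (hcd : c ≤ d)
    (h : ∀ y ∈ Icc c d, HasDerivAt G (F (x + y * I)) (x + y * I))
    (hF : ContinuousOn F {z | z.re = x ∧ z.im ∈ Icc c d}) :
    I * ∫ y in c..d, F (x + y * I) = G (x + d * I) - G (x + c * I) := by
  rw [← intervalIntegral.integral_const_mul]
  refine intervalIntegral.integral_eq_sub_of_hasDerivAt (f := fun y : ℝ => G (x + y * I))
    (fun y hy => ?_) ((hF.intervalIntegrable_vertical hcd fun y hy => by simpa using hy).const_mul I)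
  rw [uIcc_of_le hcd] at hy
  have h1 : HasDerivAt (fun y : ℝ => (x + y * I : ℂ)) I y := by
    simpa using ((Complex.ofRealCLM.hasDerivAt (x := y)).mul_const I).const_add (x : ℂ)
  simpa [Function.comp_def, mul_comm] using (h y hy).comp y h1

theorem log_neg_eq_sub {w : ℂ} (h : 0 < w.im) : log (-w) = log w - Real.pi * I := by
  rw [log, log, norm_neg, arg_neg_eq_arg_sub_pi_of_im_pos h]
  push_cast
  ring

theorem log_neg_eq_add {w : ℂ} (h : w.im < 0) : log (-w) = log w + Real.pi * I := by
  rw [log, log, norm_neg, arg_neg_eq_arg_add_pi_of_im_neg h]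
  push_cast
  ring

/-- The principal branch log(z - u) is a primitive on the bottom, right and top sides. The left side
crosses its cut, so log(-(z - u)) is used there; the two branches differ by ±πi at the left corners,
and these differences add up to 2πi. -/
theorem rectIntegral_inv_sub {u : ℂ} (ha : a < u.re) (hb : u.re < b) (hc : c < u.im)
    (hd : u.im < d) : rectIntegral (fun z => (z - u)⁻¹) a b c d = 2 * Real.pi * I := by
  have hab : a ≤ b := (ha.trans hb).le
  have hcd : c ≤ d := (hc.trans hd).le
  have hlog : ∀ z, z - u ∈ slitPlane → HasDerivAt (fun z => log (z - u)) (z - u)⁻¹ z := fun z hz => by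
    simpa using ((hasDerivAt_id z).sub_const u).clog hz
  have hlog' : ∀ z, -(z - u) ∈ slitPlane →
      HasDerivAt (fun z => log (-(z - u))) (z - u)⁻¹ z := fun z hz => by
    have := ((hasDerivAt_id z).sub_const u).neg.clog hz
    refine this.congr_deriv ?_
    change -1 / -(z - u) = _
    rw [neg_div_neg_eq, one_div]
  have hcont : ∀ s : Set ℂ, (∀ z ∈ s, z ≠ u) → ContinuousOn (fun z => (z - u)⁻¹) s := fun s hs =>
    ContinuousOn.inv₀ (by fun_prop) fun z hz => sub_ne_zero.2 (hs z hz)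
  unfold rectIntegral
  rw [integral_horizontal_eq_sub (F := fun z => (z - u)⁻¹) (G := fun z => log (z - u)) hab
      (fun x hx => hlog _ (by right; simp; linarith))
      (hcont _ fun z hz h => by simp [h] at hz; linarith),
    integral_horizontal_eq_sub (F := fun z => (z - u)⁻¹) (G := fun z => log (z - u)) hab
      (fun x hx => hlog _ (by right; simp; linarith))
      (hcont _ fun z hz h => by simp [h] at hz; linarith),
    integral_vertical_eq_sub (F := fun z => (z - u)⁻¹) (G := fun z => log (z - u)) hcd
      (fun x hx => hlog _ (by left; simp; linarith))
      (hcont _ fun z hz h => by simp [h] at hz; linarith),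
    integral_vertical_eq_sub (F := fun z => (z - u)⁻¹) (G := fun z => log (-(z - u))) hcd
      (fun x hx => hlog' _ (by left; simp; linarith))
      (hcont _ fun z hz h => by simp [h] at hz; linarith),
    log_neg_eq_sub (w := a + d * I - u) (by simp; linarith),
    log_neg_eq_add (w := a + c * I - u) (by simp; linarith)]
  ring

theorem isCompact_closedRect : IsCompact (closedRect a b c d) := isCompact_Icc.reProdIm isCompact_Icc

theorem convex_closedRect : Convex ℝ (closedRect a b c d) :=
  ((convex_Icc a b).is_linear_preimage reLm.isLinear).inter
    ((convex_Icc c d).is_linear_preimage imLm.isLinear)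

/-- The argument principle for a rectangle. -/
theorem rectIntegral_logDeriv {f : ℂ → ℂ} (hab : a < b) (hcd : c < d)
    (hf : AnalyticOnNhd ℂ f (closedRect a b c d)) (h0 : ∀ z ∈ rectBoundary a b c d, f z ≠ 0) :
    rectIntegral (logDeriv f) a b c d
      = 2 * Real.pi * I * (∑ᶠ u ∈ closedRect a b c d, zeroMultiplicity f u : ℕ) := by
  have hac : (⟨a, c⟩ : ℂ) ∈ rectBoundary a b c d := by
    simp [rectBoundary, mem_closedRect, hab.le, hcd.le]
  have hbc : (⟨b, c⟩ : ℂ) ∈ rectBoundary a b c d := by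
    simp [rectBoundary, mem_closedRect, hab.le, hcd.le]
  obtain ⟨S, g, hSU, hSn, hS0, hg, hg0, hfg⟩ := hf.exists_eq_prod_mul isCompact_closedRect
    convex_closedRect.isPreconnected
    ⟨⟨a, c⟩, hac.1, ⟨b, c⟩, hbc.1, fun h => hab.ne (congrArg re h)⟩ hac.1 (h0 _ hac)
  have hne : ∀ z ∈ rectBoundary a b c d, ∀ u ∈ S, z ≠ u := fun z hz u hu h =>
    h0 z hz (h ▸ hS0 u hu)
  have hlg : DifferentiableOn ℂ (logDeriv g) (closedRect a b c d) := fun z hz =>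
    ((hg z hz).deriv.differentiableAt.div (hg z hz).differentiableAt
      (hg0 z hz)).differentiableWithinAt
  have hinv : ∀ u ∈ S, ContinuousOn (fun z => (zeroMultiplicity f u : ℂ) * (z - u)⁻¹)
      (rectBoundary a b c d) := fun u hu => continuousOn_const.mul
    (ContinuousOn.inv₀ (by fun_prop) fun z hz => sub_ne_zero.2 (hne z hz u hu))
  rw [rectIntegral_congr hab.le hcd.le (fun z hz => logDeriv_eq_sum_add (p := fun u => u) (hfg z hz.1)
      (hne z hz) (hg z hz.1).differentiableAt (hg0 z hz.1)),
    rectIntegral_add hab.le hcd.le (continuousOn_finsetSum _ hinv)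
      (hlg.continuousOn.mono fun z hz => hz.1),
    rectIntegral_eq_zero hab.le hcd.le hlg, rectIntegral_sum _ hab.le hcd.le hinv, add_zero]
  have hsum : ∑ᶠ u ∈ closedRect a b c d, zeroMultiplicity f u = ∑ u ∈ S, zeroMultiplicity f u := by
    refine finsum_mem_eq_sum_of_inter_support_eq _ ?_
    ext u
    simp only [mem_inter_iff, Function.mem_support, Finset.mem_coe]
    refine ⟨fun h => ⟨by_contra fun hu => h.2 (hSn u h.1 hu), h.2⟩, fun h => ⟨hSU h.1, h.2⟩⟩
  rw [hsum, Nat.cast_sum, Finset.mul_sum]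
  refine Finset.sum_congr rfl fun u hu => ?_
  have hu1 := mem_closedRect.1 (hSU hu)
  have hub : u ∉ rectBoundary a b c d := fun h => h0 u h (hS0 u hu)
  simp only [rectBoundary, mem_sep_iff, hSU hu, true_and, not_or] at hub
  rw [rectIntegral_const_mul, rectIntegral_inv_sub (lt_of_le_of_ne hu1.1.1 (Ne.symm hub.1))
    (lt_of_le_of_ne hu1.1.2 hub.2.1) (lt_of_le_of_ne hu1.2.1 (Ne.symm hub.2.2.1))
    (lt_of_le_of_ne hu1.2.2 hub.2.2.2)]
  ring

end rect

/-! ### Backlund's bound for the variation of the argument. -/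

/-- Seen from u, a horizontal segment stays in one half-plane and subtends an angle of at most π. If
u lies on the same horizontal line, the integrand is real. -/
theorem abs_im_integral_inv_sub_le {a b y : ℝ} {u : ℂ} (hab : a ≤ b)
    (hu : ∀ x ∈ Icc a b, (x + y * I : ℂ) ≠ u) :
    |(∫ x in a..b, (x + y * I - u : ℂ)⁻¹).im| ≤ Real.pi := by
  have hcont : ContinuousOn (fun z : ℂ => (z - u)⁻¹) {z | z.im = y ∧ z.re ∈ Icc a b} := by
    refine ContinuousOn.inv₀ (by fun_prop) fun z hz => sub_ne_zero.2 ?_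
    have := hu z.re hz.2
    rwa [← hz.1, re_add_im] at this
  rcases eq_or_ne y u.im with h | h
  · have hint := hcont.intervalIntegrable_horizontal (y := y) hab fun x hx => by simpa using hx
    rw [← imCLM_apply, ← ContinuousLinearMap.intervalIntegral_comp_comm _ hint]
    simp [h, Real.pi_nonneg]
  · rw [integral_horizontal_eq_sub (F := fun z => (z - u)⁻¹) (G := fun z => log (z - u)) hab
      (fun x hx => ?_) hcont, sub_im, log_im, log_im]
    · rcases lt_or_gt_of_ne h with h | h
      · have h1 : ∀ x : ℝ, arg (x + y * I - u) < 0 := fun x => arg_neg_iff.2 (by simpa using h)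
        rw [abs_le]
        constructor <;> linarith [h1 a, h1 b, neg_pi_lt_arg (a + y * I - u),
          neg_pi_lt_arg (b + y * I - u)]
      · have h1 : ∀ x : ℝ, 0 ≤ arg (x + y * I - u) := fun x => arg_nonneg_iff.2 (by simpa using h.le)
        rw [abs_le]
        constructor <;> linarith [h1 a, h1 b, arg_le_pi (a + y * I - u), arg_le_pi (b + y * I - u)]
    · have : (x + y * I - u : ℂ) ∈ slitPlane := by
        right; simpa [sub_eq_zero] using h
      simpa using ((hasDerivAt_id (x + y * I : ℂ)).sub_const u).clog this

/-- A Blaschke reflection: on |z| = R one has R² = z · conj z, so the left-hand factor equals z ·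
conj(z - u) / R. Zeros can thus be moved out of the disc without changing the modulus on its
boundary. -/
theorem norm_sub_reflection_mul {R : ℝ} {z u : ℂ} (hR : 0 < R) (hz : ‖z‖ = R) (hu : u ≠ 0) :
    ‖(z - R ^ 2 / (starRingEnd ℂ) u) * (-(starRingEnd ℂ) u / R)‖ = ‖z - u‖ := by
  have hu' : (starRingEnd ℂ) u ≠ 0 := by simpa using hu
  have hR' : (R : ℂ) ≠ 0 := by exact_mod_cast hR.ne'
  have h1 : (R : ℂ) ^ 2 = z * (starRingEnd ℂ) z := by
    rw [mul_conj, normSq_eq_norm_sq, hz]; push_cast; rfl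
  have h2 : (z - R ^ 2 / (starRingEnd ℂ) u) * (-(starRingEnd ℂ) u / R)
      = z * (starRingEnd ℂ) (z - u) / R := by
    rw [map_sub, h1]
    field_simp
    ring
  rw [h2, norm_div, norm_mul, RCLike.norm_conj, hz, norm_real, Real.norm_of_nonneg hR.le]
  field_simp

/-- The variation of a logarithm along a radius, for a function without zeros in a disc. -/
theorem norm_integral_logDeriv_le {h : ℂ → ℂ} {r r₁ B : ℝ} (hr : 0 ≤ r) (hr₁ : r < r₁) (hB : 0 < B)
    (hh : AnalyticOnNhd ℂ h (Metric.ball 0 r₁)) (h0 : ∀ z ∈ Metric.ball 0 r₁, h z ≠ 0)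
    (hle : ∀ z ∈ Metric.ball 0 r₁, ‖h z‖ ≤ Real.exp B * ‖h 0‖) :
    ‖∫ x in -r..0, logDeriv h (x + (0 : ℝ) * I)‖ ≤ 2 * B * r / (r₁ - r) := by
  have hd : DifferentiableOn ℂ (logDeriv h) (Metric.ball 0 r₁) := fun z hz =>
    ((hh z hz).deriv.differentiableAt.div (hh z hz).differentiableAt (h0 z hz)).differentiableWithinAt
  -- `H` is a branch of log(h / h 0). The hypothesis on the norm becomes re H ≤ B, which is what
  -- Borel–Carathéodory needs.
  obtain ⟨H, H0, hH⟩ := hd.isExactOn_ball.with_val_at 0 0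
  have hr₁0 : 0 < r₁ := hr.trans_lt hr₁
  have hzero : (0 : ℂ) ∈ Metric.ball (0 : ℂ) r₁ := Metric.mem_ball_self hr₁0
  have hexp : ∀ z ∈ Metric.ball 0 r₁, h z = h 0 * exp (H z) := by
    intro z hz
    have hder : ∀ z ∈ Metric.ball 0 r₁, HasDerivAt (fun z => h z * exp (-H z)) 0 z := fun z hz => by
      have := (hh z hz).differentiableAt.hasDerivAt.mul (hH z hz).neg.cexp
      refine this.congr_deriv ?_
      rw [logDeriv_apply]
      have := h0 z hz
      field_simp
      ring
    have := Metric.isOpen_ball.is_const_of_deriv_eq_zero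
      (Metric.isPreconnected_ball) (fun z hz => (hder z hz).differentiableAt.differentiableWithinAt)
      (fun z hz => (hder z hz).deriv) hz hzero
    simp only [H0, neg_zero, exp_zero, mul_one] at this
    rw [← this, mul_assoc, ← exp_add]
    simp
  have hmaps : MapsTo H (Metric.ball 0 r₁) {z | z.re ≤ B} := fun z hz => by
    have h1 := hle z hz
    rw [hexp z hz, norm_mul, norm_exp, mul_comm] at h1
    exact Real.exp_le_exp.1 (le_of_mul_le_mul_right h1 (norm_pos_iff.2 (h0 0 hzero)))
  have hmem : ∀ x ∈ Icc (-r) 0, (x + (0 : ℝ) * I : ℂ) ∈ Metric.ball (0 : ℂ) r₁ := fun x hx => by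
    simp only [ofReal_zero, zero_mul, add_zero, mem_ball_zero_iff, norm_real, Real.norm_eq_abs]
    rw [abs_of_nonpos hx.2]
    linarith [hx.1]
  have hz := hmem (-r) ⟨le_rfl, by linarith⟩
  rw [integral_horizontal_eq_sub (by linarith) (fun x hx => hH _ (hmem x hx))
    (hd.continuousOn.mono fun z hz => by
      have := hmem z.re hz.2
      rwa [← hz.1, re_add_im] at this)]
  have hBC := borelCaratheodory_zero hB
    (fun z hz => (hH z hz).differentiableAt.differentiableWithinAt) hmaps hr₁0 hz H0
  have hn : ‖((-r : ℝ) : ℂ) + (0 : ℝ) * I‖ = r := by simp [abs_of_nonneg hr]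
  rw [hn] at hBC
  simpa [H0] using hBC

/-- Backlund's bound for the variation of the argument, on a disc centred at the origin. -/
theorem abs_im_integral_logDeriv_le_zero {f : ℂ → ℂ} {r r₁ R M m : ℝ} (hr : 0 ≤ r) (hr₁ : r < r₁)
    (hR : r₁ < R) (hm : 0 < m) (hf : AnalyticOnNhd ℂ f (Metric.closedBall 0 R))
    (hM : ∀ z ∈ Metric.closedBall 0 R, ‖f z‖ ≤ M) (hm0 : m ≤ ‖f 0‖)
    (hseg : ∀ x ∈ Icc (-r) 0, f (x + (0 : ℝ) * I) ≠ 0) :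
    |(∫ x in -r..0, logDeriv f (x + (0 : ℝ) * I)).im|
      ≤ (2 * Real.pi / Real.log (R / r₁) + 2 * r / (r₁ - r)) * (Real.log (M / m) + 1) := by
  have hr₁0 : 0 < r₁ := hr.trans_lt hr₁
  have hR0 : 0 < R := hr₁0.trans hR
  have hzR : (0 : ℂ) ∈ Metric.closedBall (0 : ℂ) R := Metric.mem_closedBall_self hR0.le
  have hf0 : f 0 ≠ 0 := norm_pos_iff.1 (hm.trans_le hm0)
  obtain ⟨S, g, hSU, -, hS0, hg, hg0, hfg⟩ := hf.exists_eq_prod_mul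
    (isCompact_closedBall 0 R) (convex_closedBall 0 R).isPreconnected
    ⟨0, hzR, (R : ℂ), by simp [abs_of_pos hR0], by exact_mod_cast hR0.ne⟩ hzR hf0
  set n := zeroMultiplicity f
  classical
  -- Only the zeros in the smaller disc of radius r₁ are reflected; those further out stay in `g₂`
  -- and do no harm.
  set S₁ := S.filter fun u => ‖u‖ ≤ r₁ with hS₁
  set g₂ : ℂ → ℂ := fun s => (∏ u ∈ S.filter fun u => ¬ ‖u‖ ≤ r₁, (s - u) ^ n u) * g s with hg₂
  have hfg₂ : ∀ z ∈ Metric.closedBall (0 : ℂ) R,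
      f =ᶠ[𝓝 z] fun s => (∏ u ∈ S₁, (s - u) ^ n u) * g₂ s := fun z hz => by
    filter_upwards [hfg z hz] with s hs
    rw [hs, hg₂, ← mul_assoc, hS₁, Finset.prod_filter_mul_prod_filter_not]
  have hg₂an : AnalyticOnNhd ℂ g₂ (Metric.closedBall 0 R) := fun z hz => by
    have := hg z hz
    fun_prop
  have hball : Metric.closedBall (0 : ℂ) r₁ ⊆ Metric.closedBall 0 R :=
    Metric.closedBall_subset_closedBall hR.le
  have hg₂0 : ∀ z ∈ Metric.closedBall (0 : ℂ) r₁, g₂ z ≠ 0 := fun z hz =>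
    mul_ne_zero (Finset.prod_ne_zero_iff.2 fun u hu => pow_ne_zero _ (sub_ne_zero.2 fun h => by
      rw [Finset.mem_filter] at hu
      exact hu.2 (h ▸ by simpa using hz))) (hg0 z (hball hz))
  have hu0 : ∀ u ∈ S₁, u ≠ 0 := fun u hu h => by
    subst h
    exact hf0 (hS0 _ (Finset.mem_filter.1 hu).1)
  have hur : ∀ u ∈ S₁, ‖u‖ ≤ r₁ := fun u hu => (Finset.mem_filter.1 hu).2
  -- The mirror image of u in the circle |z| = R. Its modulus R² / |u| ≥ R² / r₁ exceeds R, so `h`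
  -- below is free of zeros in |z| ≤ r₁.
  set p : ℂ → ℂ := fun u => R ^ 2 / (starRingEnd ℂ) u with hp
  have hpR : ∀ u ∈ S₁, ∀ z ∈ Metric.closedBall (0 : ℂ) r₁, z ≠ p u := fun u hu z hz h => by
    have h1 : 0 < ‖u‖ := norm_pos_iff.2 (hu0 u hu)
    have h2 : ‖p u‖ = R ^ 2 / ‖u‖ := by simp [hp]
    have h3 : ‖p u‖ ≤ r₁ := by rw [← h]; simpa using hz
    rw [h2, div_le_iff₀ h1] at h3
    nlinarith [hur u hu]
  set k : ℂ := ∏ u ∈ S₁, (-(starRingEnd ℂ) u / R) ^ n u with hk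
  have hR' : (R : ℂ) ≠ 0 := by exact_mod_cast hR0.ne'
  have hk0 : k ≠ 0 := Finset.prod_ne_zero_iff.2 fun u hu => pow_ne_zero _
    (div_ne_zero (neg_ne_zero.2 (by simpa using hu0 u hu)) hR')
  set h : ℂ → ℂ := fun s => (∏ u ∈ S₁, (s - p u) ^ n u) * (k * g₂ s) with hh
  have hhan : AnalyticOnNhd ℂ h (Metric.closedBall 0 R) := fun z hz => by
    have := hg₂an z hz
    fun_prop
  have hh0 : ∀ z ∈ Metric.closedBall (0 : ℂ) r₁, h z ≠ 0 := fun z hz =>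
    mul_ne_zero (Finset.prod_ne_zero_iff.2 fun u hu => pow_ne_zero _ (sub_ne_zero.2 (hpR u hu z hz)))
      (mul_ne_zero hk0 (hg₂0 z hz))
  have hheq : ∀ s, h s = (∏ u ∈ S₁, ((s - p u) * (-(starRingEnd ℂ) u / R)) ^ n u) * g₂ s := fun s => by
    simp only [hh, hk, mul_pow, Finset.prod_mul_distrib]
    ring
  have hnh : ∀ s, ‖h s‖ = (∏ u ∈ S₁, ‖(s - p u) * (-(starRingEnd ℂ) u / R)‖ ^ n u) * ‖g₂ s‖ :=
    fun s => by
      rw [hheq]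
      refine (norm_mul _ _).trans ?_
      rw [norm_prod]
      simp only [norm_pow]
  have hnf : ∀ s ∈ Metric.closedBall (0 : ℂ) R, ‖f s‖ = (∏ u ∈ S₁, ‖s - u‖ ^ n u) * ‖g₂ s‖ :=
    fun s hs => by
      rw [(hfg₂ s hs).eq_of_nhds]
      refine (norm_mul _ _).trans ?_
      rw [norm_prod]
      simp only [norm_pow]
  -- Since |h| = |f| on |z| = R, the maximum principle carries the bound M over to `h`.
  have hhM : ∀ z ∈ Metric.closedBall (0 : ℂ) R, ‖h z‖ ≤ M := by
    intro z hz
    refine norm_le_of_forall_mem_frontier_norm_le (U := Metric.ball 0 R) Metric.isBounded_ball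
      ?_ (fun w hw => ?_) (by rwa [closure_ball _ hR0.ne'])
    · refine DifferentiableOn.diffContOnCl ?_
      rw [closure_ball _ hR0.ne']
      exact hhan.differentiableOn
    · rw [frontier_ball _ hR0.ne'] at hw
      have hwR : ‖w‖ = R := by simpa using hw
      have hwc := Metric.sphere_subset_closedBall hw
      refine le_trans (le_of_eq ?_) (hM w hwc)
      rw [hnh, hnf w hwc]
      congr 1
      refine Finset.prod_congr rfl fun u hu => ?_
      rw [norm_sub_reflection_mul hR0 hwR (hu0 u hu)]
  set N : ℕ := ∑ u ∈ S₁, n u with hN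
  -- Jensen's inequality in weak form: at the centre a reflected factor has modulus R and the
  -- original one at most r₁. This bounds the number N of reflected zeros by log(M/m) / log(R/r₁).
  have hh00 : ‖f 0‖ ≤ (r₁ / R) ^ N * ‖h 0‖ := by
    rw [hnh, hnf 0 hzR, ← mul_assoc, hN, ← Finset.prod_pow_eq_pow_sum, ← Finset.prod_mul_distrib]
    gcongr with u hu
    rw [← mul_pow]
    gcongr
    have hcu : (starRingEnd ℂ) u ≠ 0 := by simpa using hu0 u hu
    have : (0 - p u) * (-(starRingEnd ℂ) u / R) = R := by
      simp only [hp]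
      field_simp
      ring
    rw [this, norm_real, Real.norm_of_nonneg hR0.le, div_mul_cancel₀ _ hR0.ne', zero_sub, norm_neg]
    exact hur u hu
  have hpow : (r₁ / R) ^ N ≤ 1 := pow_le_one₀ (by positivity) ((div_le_one hR0).2 hR.le)
  have hh0m : m ≤ ‖h 0‖ := hm0.trans (hh00.trans (mul_le_of_le_one_left (norm_nonneg _) hpow))
  have hMm : m ≤ M := hm0.trans (hM 0 hzR)
  have hM0 : 0 < M := hm.trans_le hMm
  -- The summand 1 keeps B positive even when M = m.
  set B := Real.log (M / m) + 1 with hB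
  have hlog0 : 0 ≤ Real.log (M / m) := Real.log_nonneg ((one_le_div hm).2 hMm)
  have hNB : N ≤ B / Real.log (R / r₁) := by
    have hl : 0 < Real.log (R / r₁) := Real.log_pos ((one_lt_div hr₁0).2 hR)
    rw [le_div_iff₀ hl]
    have h1 : (R / r₁) ^ N ≤ M / m := by
      rw [le_div_iff₀ hm]
      have h2 : m ≤ (r₁ / R) ^ N * M :=
        hm0.trans (hh00.trans (by gcongr; exact hhM 0 hzR))
      calc (R / r₁) ^ N * m ≤ (R / r₁) ^ N * ((r₁ / R) ^ N * M) := by gcongr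
        _ = M := by rw [← mul_assoc, ← mul_pow]; field_simp; simp
    have h3 := Real.log_le_log (by positivity) h1
    rw [Real.log_pow] at h3
    linarith
  have hball' : Metric.ball (0 : ℂ) r₁ ⊆ Metric.closedBall 0 r₁ := Metric.ball_subset_closedBall
  have hH := norm_integral_logDeriv_le hr hr₁ (B := B) (by linarith)
    (fun z hz => hhan z (hball (hball' hz))) (fun z hz => hh0 z (hball' hz)) (fun z hz => by
      refine (hhM z (hball (hball' hz))).trans ?_
      have : M / m ≤ Real.exp B := by
        rw [← Real.log_le_iff_le_exp (by positivity)]; linarith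
      rw [div_le_iff₀ hm] at this
      exact this.trans (by gcongr))
  have hmem : ∀ x ∈ Icc (-r) 0, (x + (0 : ℝ) * I : ℂ) ∈ Metric.closedBall (0 : ℂ) r₁ := fun x hx => by
    simp only [ofReal_zero, zero_mul, add_zero, mem_closedBall_zero_iff, norm_real, Real.norm_eq_abs]
    rw [abs_of_nonpos hx.2]
    linarith [hx.1]
  have hne : ∀ x ∈ Icc (-r) 0, ∀ u ∈ S₁, (x + (0 : ℝ) * I : ℂ) ≠ u := fun x hx u hu h =>
    hseg x hx (h ▸ hS0 u (Finset.mem_filter.1 hu).1)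
  have hrle : -r ≤ 0 := by linarith
  -- Each reflected zero contributes the angle seen from u minus the angle seen from its mirror
  -- image, hence at most 2π; the rest is the variation of log h.
  have hlogd : ∀ x ∈ Icc (-r) 0, logDeriv f (x + (0 : ℝ) * I)
      = ∑ u ∈ S₁, n u * ((x + (0 : ℝ) * I - u)⁻¹ - (x + (0 : ℝ) * I - p u)⁻¹)
        + logDeriv h (x + (0 : ℝ) * I) := fun x hx => by
    have hz := hmem x hx
    have hd := (hg₂an _ (hball hz)).differentiableAt
    rw [logDeriv_eq_sum_add (p := fun u => u) (hfg₂ _ (hball hz)) (hne x hx) hd (hg₂0 _ hz),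
      logDeriv_eq_sum_add (f := h) (S := S₁) (p := p) (n := n) (g := fun s => k * g₂ s)
        (Eventually.of_forall fun s => rfl)
        (fun u hu => hpR u hu _ hz) (hd.const_mul k) (mul_ne_zero hk0 (hg₂0 _ hz)),
      logDeriv_const_mul _ _ hk0]
    simp only [mul_sub, Finset.sum_sub_distrib]
    ring
  have hi1 : ∀ (q : ℂ), (∀ x ∈ Icc (-r) 0, (x + (0 : ℝ) * I : ℂ) ≠ q) →
      IntervalIntegrable (fun x : ℝ => (x + (0 : ℝ) * I - q : ℂ)⁻¹) MeasureTheory.volume (-r) 0 :=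
    fun q hq => by
      apply ContinuousOn.intervalIntegrable
      rw [uIcc_of_le hrle]
      exact ContinuousOn.inv₀ (by fun_prop) fun x hx => sub_ne_zero.2 (hq x hx)
  have hi2 : IntervalIntegrable (fun x : ℝ => logDeriv h (x + (0 : ℝ) * I))
      MeasureTheory.volume (-r) 0 := by
    refine ContinuousOn.intervalIntegrable_horizontal (s := Metric.closedBall 0 r₁) hrle ?_ hmem
    exact fun z hz => ((hhan z (hball hz)).deriv.differentiableAt.div
      (hhan z (hball hz)).differentiableAt (hh0 z hz)).continuousAt.continuousWithinAt
  have hi3 : ∀ u ∈ S₁, IntervalIntegrable (fun x : ℝ => (n u : ℂ) *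
      ((x + (0 : ℝ) * I - u : ℂ)⁻¹ - (x + (0 : ℝ) * I - p u)⁻¹)) MeasureTheory.volume (-r) 0 :=
    fun u hu => ((hi1 u fun x hx => hne x hx u hu).sub
      (hi1 (p u) fun x hx => hpR u hu _ (hmem x hx))).const_mul _
  have hi4 : IntervalIntegrable (fun x : ℝ => ∑ u ∈ S₁, (n u : ℂ) *
      ((x + (0 : ℝ) * I - u : ℂ)⁻¹ - (x + (0 : ℝ) * I - p u)⁻¹)) MeasureTheory.volume (-r) 0 := by
    simpa only [Finset.sum_fn] using IntervalIntegrable.sum S₁ hi3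
  rw [intervalIntegral.integral_congr (g := fun x : ℝ =>
      ∑ u ∈ S₁, n u * ((x + (0 : ℝ) * I - u : ℂ)⁻¹ - (x + (0 : ℝ) * I - p u)⁻¹)
        + logDeriv h (x + (0 : ℝ) * I)) (fun x hx => hlogd x (by rwa [uIcc_of_le hrle] at hx)),
    intervalIntegral.integral_add hi4 hi2, intervalIntegral.integral_finsetSum hi3, add_im, im_sum]
  have hS : |∑ u ∈ S₁, (∫ x in -r..0, (n u : ℂ) *
      ((x + (0 : ℝ) * I - u : ℂ)⁻¹ - (x + (0 : ℝ) * I - p u)⁻¹)).im| ≤ N * (2 * Real.pi) := by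
    rw [hN, Nat.cast_sum, Finset.sum_mul]
    refine (Finset.abs_sum_le_sum_abs _ _).trans (Finset.sum_le_sum fun u hu => ?_)
    rw [intervalIntegral.integral_const_mul, intervalIntegral.integral_sub
      (hi1 u fun x hx => hne x hx u hu) (hi1 (p u) fun x hx => hpR u hu _ (hmem x hx)),
      ← ofReal_natCast, im_ofReal_mul, abs_mul, Nat.abs_cast, sub_im]
    gcongr
    refine (abs_sub _ _).trans ?_
    linarith [abs_im_integral_inv_sub_le hrle fun x hx => hne x hx u hu,
      abs_im_integral_inv_sub_le hrle fun x hx => hpR u hu _ (hmem x hx)]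
  refine (abs_add_le _ _).trans ((add_le_add hS ((abs_im_le_norm _).trans hH)).trans ?_)
  have : N * (2 * Real.pi) ≤ B / Real.log (R / r₁) * (2 * Real.pi) := by gcongr
  refine (add_le_add_left this _).trans (le_of_eq ?_)
  ring

/-- Backlund's bound for the variation of the argument along a horizontal radius of a disc. -/
theorem abs_im_integral_logDeriv_le {f : ℂ → ℂ} {c : ℂ} {r r₁ R M m : ℝ} (hr : 0 ≤ r)
    (hr₁ : r < r₁) (hR : r₁ < R) (hm : 0 < m) (hf : AnalyticOnNhd ℂ f (Metric.closedBall c R))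
    (hM : ∀ z ∈ Metric.closedBall c R, ‖f z‖ ≤ M) (hm0 : m ≤ ‖f c‖)
    (hseg : ∀ x ∈ Icc (c.re - r) c.re, f (x + c.im * I) ≠ 0) :
    |(∫ x in (c.re - r)..c.re, logDeriv f (x + c.im * I)).im|
      ≤ (2 * Real.pi / Real.log (R / r₁) + 2 * r / (r₁ - r)) * (Real.log (M / m) + 1) := by
  have hmem : ∀ z ∈ Metric.closedBall (0 : ℂ) R, z + c ∈ Metric.closedBall c R := fun z hz => by
    simpa [dist_eq_norm] using hz
  have hx : ∀ x : ℝ, (x + (0 : ℝ) * I : ℂ) + c = (x + c.re : ℝ) + c.im * I := fun x => by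
    apply Complex.ext <;> simp
  have := abs_im_integral_logDeriv_le_zero (f := fun z => f (z + c)) hr hr₁ hR hm
    (fun z hz => (hf _ (hmem z hz)).fun_comp_of_eq (g := f) (f := fun z => z + c) (by fun_prop) rfl) (fun z hz => hM _ (hmem z hz)) (by simpa)
    (fun x hx' => by
      simp only [hx]
      exact hseg _ ⟨by linarith [hx'.1], by linarith [hx'.2]⟩)
  have hl : ∀ z, logDeriv (fun z => f (z + c)) z = logDeriv f (z + c) := fun z => by
    simp only [logDeriv_apply, deriv_comp_add_const]
  simp only [hl, hx] at this
  rw [intervalIntegral.integral_comp_add_right (fun x : ℝ => logDeriv f (x + c.im * I))] at this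
  rwa [zero_add, show -r + c.re = c.re - r by ring] at this

/-! ### Stirling's formula for the argument of the Gamma function. -/

/-- The real number `θ` is an argument of `z`. -/
def HasPhase (z : ℂ) (θ : ℝ) : Prop := z = ‖z‖ * exp (θ * I)

theorem HasPhase.mul {z w : ℂ} {θ η : ℝ} (hz : HasPhase z θ) (hw : HasPhase w η) :
    HasPhase (z * w) (θ + η) := by
  unfold HasPhase at *
  rw [norm_mul, ofReal_add, add_mul, exp_add, ofReal_mul]
  nth_rw 1 [hz, hw]
  ring

theorem HasPhase.inv {z : ℂ} {θ : ℝ} (hz : HasPhase z θ) : HasPhase z⁻¹ (-θ) := by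
  unfold HasPhase at *
  rw [norm_inv, ofReal_neg, neg_mul, exp_neg, ofReal_inv, ← mul_inv, ← hz]

theorem HasPhase.prod {ι : Type*} (S : Finset ι) {z : ι → ℂ} {θ : ι → ℝ}
    (h : ∀ i ∈ S, HasPhase (z i) (θ i)) : HasPhase (∏ i ∈ S, z i) (∑ i ∈ S, θ i) := by
  classical
  induction S using Finset.induction_on with
  | empty => simp [HasPhase]
  | insert i S hi ih =>
    rw [Finset.prod_insert hi, Finset.sum_insert hi]
    exact (h i (by simp)).mul (ih fun j hj => h j (by simp [hj]))

theorem HasPhase.of_nonneg {r : ℝ} (hr : 0 ≤ r) : HasPhase r 0 := by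
  simp [HasPhase, abs_of_nonneg hr]

theorem HasPhase.exp (z : ℂ) : HasPhase (exp z) z.im := by
  unfold HasPhase
  rw [norm_exp, ofReal_exp, ← exp_add, re_add_im]

theorem HasPhase.arctan {z : ℂ} (hz : 0 < z.re) : HasPhase z (Real.arctan (z.im / z.re)) := by
  unfold HasPhase
  have := abs_lt.1 (abs_arg_lt_pi_div_two_iff.2 (Or.inl hz))
  rw [← tan_arg, Real.arctan_tan this.1 this.2, norm_mul_exp_arg_mul_I]

/-- The argument of `GammaSeq (b + i t) n`, as a continuous function of `t` vanishing at `0`. -/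
noncomputable def gammaPhase (b : ℝ) (n : ℕ) (t : ℝ) : ℝ :=
  t * Real.log n - ∑ k ∈ Finset.range (n + 1), Real.arctan (t / (b + k))

theorem hasPhase_GammaSeq {b : ℝ} (hb : 0 < b) (t : ℝ) {n : ℕ} (hn : n ≠ 0) :
    HasPhase (GammaSeq (b + t * I) n) (gammaPhase b n t) := by
  have h1 : HasPhase ((n : ℂ) ^ (b + t * I : ℂ)) (t * Real.log n) := by
    rw [cpow_def_of_ne_zero (by exact_mod_cast hn)]
    have := HasPhase.exp (Real.log n * (b + t * I))
    rwa [im_ofReal_mul, add_im, ofReal_im, zero_add, im_ofReal_mul, I_im, mul_one,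
      mul_comm (Real.log n) t, natCast_log] at this
  have h2 : HasPhase (n.factorial : ℂ) 0 := by
    have := HasPhase.of_nonneg (Nat.cast_nonneg (α := ℝ) n.factorial)
    simpa using this
  have h3 : HasPhase (∏ j ∈ Finset.range (n + 1), ((b + t * I : ℂ) + j))
      (∑ k ∈ Finset.range (n + 1), Real.arctan (t / (b + k))) :=
    HasPhase.prod _ fun k _ => by
      have := HasPhase.arctan (z := (b + t * I : ℂ) + k) (by simp; positivity)
      simpa using this
  have := (h1.mul h2).mul h3.inv
  rwa [add_zero, ← sub_eq_add_neg, ← div_eq_mul_inv] at this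

theorem differentiableAt_Gamma_of_re_pos {s : ℂ} (hs : 0 < s.re) : DifferentiableAt ℂ Gamma s :=
  differentiableAt_Gamma s fun m h => by
    rw [h] at hs
    simp at hs
    linarith [Nat.cast_nonneg (α := ℝ) m]

theorem isOpen_re_pos : IsOpen {s : ℂ | 0 < s.re} := isOpen_lt continuous_const continuous_re

theorem differentiableOn_digamma : DifferentiableOn ℂ digamma {s : ℂ | 0 < s.re} := by
  have h : DifferentiableOn ℂ Gamma {s : ℂ | 0 < s.re} := fun s hs =>
    (differentiableAt_Gamma_of_re_pos hs).differentiableWithinAt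
  intro s hs
  have han := h.analyticAt (isOpen_re_pos.mem_nhds hs)
  exact (han.deriv.differentiableAt.div han.differentiableAt
    (Gamma_ne_zero_of_re_pos hs)).differentiableWithinAt

theorem continuous_digamma_vertical {b : ℝ} (hb : 0 < b) :
    Continuous fun u : ℝ => digamma (b + u * I) :=
  differentiableOn_digamma.continuousOn.comp_continuous (by fun_prop) fun u => by simpa using hb

/-- With Θ the primitive of the digamma function along the line, Γ(b+it) exp(-iΘ(t)) has derivative
zero, so it keeps its positive value Γ(b). -/
theorem hasPhase_Gamma {b : ℝ} (hb : 0 < b) (t : ℝ) :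
    HasPhase (Gamma (b + t * I)) (∫ u in 0..t, digamma (b + u * I)).re := by
  set Θ : ℝ → ℂ := fun t => ∫ u in 0..t, digamma (b + u * I)
  have hΘ : ∀ t : ℝ, HasDerivAt Θ (digamma (b + t * I)) t := fun t =>
    intervalIntegral.integral_hasDerivAt_right
      ((continuous_digamma_vertical hb).intervalIntegrable _ _)
      (continuous_digamma_vertical hb).aestronglyMeasurable.stronglyMeasurableAtFilter
      (continuous_digamma_vertical hb).continuousAt
  have hG : ∀ t : ℝ, HasDerivAt (fun t : ℝ => Gamma (b + t * I) * exp (-(I * Θ t))) 0 t := fun t => by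
    have h1 : HasDerivAt (fun y : ℝ => (b + y * I : ℂ)) I t := by
      simpa using ((Complex.ofRealCLM.hasDerivAt (x := t)).mul_const I).const_add (b : ℂ)
    have hre : 0 < (b + t * I : ℂ).re := by simpa using hb
    have h2 := (differentiableAt_Gamma_of_re_pos hre).hasDerivAt.comp t h1
    have h3 := h2.mul (((hΘ t).const_mul I).neg.cexp)
    refine h3.congr_deriv ?_
    have := Gamma_ne_zero_of_re_pos hre
    rw [digamma_def, logDeriv_apply]
    simp only [Function.comp_def]
    field_simp
    ring
  have hc : Gamma (b + t * I) * exp (-(I * Θ t)) = Gamma (b + (0 : ℝ) * I) * exp (-(I * Θ 0)) :=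
    is_const_of_deriv_eq_zero (fun t => (hG t).differentiableAt) (fun t => (hG t).deriv) t 0
  have hΘ0 : Θ 0 = 0 := by simp [Θ]
  rw [hΘ0, mul_zero, neg_zero, exp_zero, mul_one, exp_neg, ofReal_zero, zero_mul, add_zero,
    mul_inv_eq_iff_eq_mul₀ (exp_ne_zero _), Gamma_ofReal] at hc
  rw [hc]
  have := (HasPhase.of_nonneg (Real.Gamma_pos_of_pos hb).le).mul (HasPhase.exp (I * Θ t))
  rwa [zero_add, I_mul_im] at this

theorem sub_sq_le_arctan {y : ℝ} (hy : 0 ≤ y) : y - y ^ 2 ≤ Real.arctan y := by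
  have hd : ∀ x : ℝ, HasDerivAt (fun x => Real.arctan x - (x - x ^ 2))
      (1 / (1 + x ^ 2) - (1 - 2 * x)) x := fun x => by
    refine ((Real.hasDerivAt_arctan x).sub ((hasDerivAt_id x).sub
      (hasDerivAt_pow 2 x))).congr_deriv ?_
    simp
  have hm : MonotoneOn (fun x => Real.arctan x - (x - x ^ 2)) (Ici 0) := by
    refine monotoneOn_of_deriv_nonneg (convex_Ici 0)
      (fun x _ => (hd x).continuousAt.continuousWithinAt)
      (fun x _ => (hd x).differentiableAt.differentiableWithinAt) fun x hx => ?_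
    rw [interior_Ici, mem_Ioi] at hx
    rw [(hd x).deriv, sub_nonneg, le_div_iff₀ (by positivity)]
    nlinarith [sq_nonneg (x - 1), mul_pos hx hx, mul_pos (mul_pos hx hx) hx]
  have := hm (mem_Ici.2 le_rfl) hy hy
  simp at this
  linarith

theorem arctan_le_of_nonneg {y : ℝ} (hy : 0 ≤ y) : Real.arctan y ≤ y := by
  have hd : ∀ x : ℝ, HasDerivAt (fun x => x - Real.arctan x) (1 - 1 / (1 + x ^ 2)) x := fun x => by
    exact (hasDerivAt_id x).sub (Real.hasDerivAt_arctan x)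
  have hm : Monotone (fun x => x - Real.arctan x) :=
    monotone_of_deriv_nonneg (fun x => (hd x).differentiableAt) fun x => by
      rw [(hd x).deriv, sub_nonneg, div_le_one (by positivity)]
      nlinarith
  have := hm hy
  simp at this
  linarith

/-- Both log((k+2)/(k+1)) and the new arctangent divided by t are 1/k + O(1/k²), so the increments
are summable, uniformly for t in [0,T]. The index starts at 1 to avoid log 0. -/
theorem abs_gammaPhase_succ_sub_le {b t T : ℝ} (hb : 0 < b) (ht : 0 ≤ t) (htT : t ≤ T) (k : ℕ) :
    |gammaPhase b (k + 2) t - gammaPhase b (k + 1) t|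
      ≤ (T * (b + 1) + T ^ 2) * (1 / ((k : ℝ) + 1) ^ 2) := by
  have hk : (0 : ℝ) ≤ k := Nat.cast_nonneg k
  have hw : gammaPhase b (k + 2) t - gammaPhase b (k + 1) t
      = t * Real.log ((k + 2) / (k + 1)) - Real.arctan (t / (b + (k + 2))) := by
    rw [gammaPhase, gammaPhase, Finset.sum_range_succ _ (k + 2), Real.log_div (by positivity)
      (by positivity)]
    push_cast
    ring
  have hlog1 : Real.log ((k + 2) / (k + 1)) ≤ 1 / (k + 1) := by
    refine (Real.log_le_sub_one_of_pos (by positivity)).trans (le_of_eq ?_)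
    field_simp
    ring
  have hlog2 : 1 / ((k : ℝ) + 2) ≤ Real.log ((k + 2) / (k + 1)) := by
    refine le_trans (le_of_eq ?_) (Real.one_sub_inv_le_log_of_pos (by positivity))
    field_simp
    ring
  have hy0 : 0 ≤ t / (b + (k + 2)) := by positivity
  have ha1 := sub_sq_le_arctan hy0
  have ha2 := arctan_le_of_nonneg hy0
  have hT : 0 ≤ T := ht.trans htT
  rw [hw, abs_le]
  constructor
  · have h1 : t / (b + (k + 2)) ≤ t * (1 / (k + 2)) := by
      rw [mul_one_div]
      exact div_le_div_of_nonneg_left ht (by positivity) (by linarith)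
    have h2 : t * (1 / ((k : ℝ) + 2)) ≤ t * Real.log ((k + 2) / (k + 1)) := by gcongr
    have h3 : 0 ≤ (T * (b + 1) + T ^ 2) * (1 / ((k : ℝ) + 1) ^ 2) := by positivity
    linarith
  · have h1 : t * Real.log ((k + 2) / (k + 1)) ≤ t * (1 / (k + 1)) := by gcongr
    have h2 : t * (1 / ((k : ℝ) + 1)) - t / (b + (k + 2)) ≤ T * (b + 1) * (1 / ((k : ℝ) + 1) ^ 2) := by
      have : t * (1 / ((k : ℝ) + 1)) - t / (b + (k + 2))
          = t * (b + 1) * (1 / (((k : ℝ) + 1) * (b + (k + 2)))) := by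
        field_simp
        ring
      rw [this]
      gcongr
      nlinarith
    have h3 : (t / (b + (k + 2))) ^ 2 ≤ T ^ 2 * (1 / ((k : ℝ) + 1) ^ 2) := by
      rw [div_pow, mul_one_div]
      exact div_le_div₀ (by positivity) (by gcongr) (by positivity)
        (pow_le_pow_left₀ (by positivity) (by linarith) 2)
    linarith

/-- The Weierstrass test makes the limit continuous. Continuity is what later fixes the argument
itself and not merely its class modulo 2π. -/
theorem exists_tendsto_gammaPhase {b : ℝ} (hb : 0 < b) :
    ∃ φ : ℝ → ℝ, φ 0 = 0 ∧ (∀ T, ContinuousOn φ (Icc 0 T)) ∧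
      ∀ t, 0 ≤ t → Tendsto (fun n => gammaPhase b n t) atTop (𝓝 (φ t)) := by
  set w : ℕ → ℝ → ℝ := fun k t => gammaPhase b (k + 2) t - gammaPhase b (k + 1) t with hw
  have hcont : ∀ n, Continuous (gammaPhase b n) := fun n => by
    unfold gammaPhase
    refine (continuous_id.mul continuous_const).sub (continuous_finsetSum _ fun k _ => ?_)
    exact Real.continuous_arctan.comp (continuous_id.div_const _)
  have hs : Summable fun k : ℕ => 1 / ((k : ℝ) + 1) ^ 2 := by
    have := (summable_nat_add_iff (f := fun n : ℕ => 1 / (n : ℝ) ^ 2) 1).2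
      (Real.summable_one_div_nat_pow.2 one_lt_two)
    simpa using this
  have hzero : ∀ n, gammaPhase b n 0 = 0 := fun n => by simp [gammaPhase]
  have hbound : ∀ T, ∀ k, ∀ t ∈ Icc 0 T, ‖w k t‖ ≤ (T * (b + 1) + T ^ 2) * (1 / ((k : ℝ) + 1) ^ 2) :=
    fun T k t ht => abs_gammaPhase_succ_sub_le hb ht.1 ht.2 k
  refine ⟨fun t => gammaPhase b 1 t + ∑' k, w k t, by simp [hw, hzero], fun T => ?_, fun t ht => ?_⟩
  · exact (hcont 1).continuousOn.add (continuousOn_tsum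
      (fun k => ((hcont _).sub (hcont _)).continuousOn) (hs.mul_left _) (hbound T))
  · have hsum : Summable fun k => w k t :=
      Summable.of_norm_bounded (hs.mul_left (t * (b + 1) + t ^ 2)) fun k => hbound t k t ⟨ht, le_rfl⟩
    have h1 := (hsum.hasSum.tendsto_sum_nat).const_add (gammaPhase b 1 t)
    rw [← tendsto_add_atTop_iff_nat 1]
    refine h1.congr fun n => ?_
    rw [hw, Finset.sum_range_sub (fun k => gammaPhase b (k + 1) t) n]
    ring

/-- The difference is continuous, vanishes at 0 and takes values in 2πℤ; were it nonzero at T, it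
would take the value π or -π on the way. -/
theorem eq_of_exp_mul_I_eq {φ θ : ℝ → ℝ} {T : ℝ} (hT : 0 ≤ T) (hφ : ContinuousOn φ (Icc 0 T))
    (hθ : ContinuousOn θ (Icc 0 T)) (h0 : φ 0 = θ 0)
    (h : ∀ t ∈ Icc 0 T, exp (φ t * I) = exp (θ t * I)) : φ T = θ T := by
  by_contra hne
  have hper : ∀ t ∈ Icc 0 T, ∃ n : ℤ, φ t - θ t = n * (2 * Real.pi) := fun t ht => by
    obtain ⟨n, hn⟩ := exp_eq_exp_iff_exists_int.1 (h t ht)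
    refine ⟨n, ?_⟩
    have : (φ t : ℂ) = θ t + n * (2 * Real.pi) := by
      refine mul_right_cancel₀ I_ne_zero ?_
      rw [hn]; ring
    have : φ t = θ t + n * (2 * Real.pi) := by exact_mod_cast this
    linarith
  obtain ⟨n, hn⟩ := hper T ⟨hT, le_rfl⟩
  have hn0 : n ≠ 0 := fun h => hne (by rw [h] at hn; simp at hn; linarith)
  have hivt := intermediate_value_uIcc (f := fun t => φ t - θ t) (a := 0) (b := T)
    (by rw [uIcc_of_le hT]; exact hφ.sub hθ)
  simp only [h0, sub_self, hn, uIcc_of_le hT] at hivt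
  have hodd : ∀ m : ℤ, (m : ℝ) * (2 * Real.pi) ≠ Real.pi ∧ (m : ℝ) * (2 * Real.pi) ≠ -Real.pi := by
    intro m
    constructor <;> intro hm
    · have : (m : ℝ) * 2 = 1 := by
        refine mul_right_cancel₀ Real.pi_ne_zero ?_
        linarith
      norm_cast at this
      omega
    · have : (m : ℝ) * 2 = -1 := by
        refine mul_right_cancel₀ Real.pi_ne_zero ?_
        linarith
      norm_cast at this
      omega
  rcases lt_or_gt_of_ne hn0 with hneg | hpos
  · have h1 : (n : ℝ) ≤ -1 := by exact_mod_cast Int.le_sub_one_of_lt hneg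
    obtain ⟨t, ht, hv⟩ := hivt (show -Real.pi ∈ uIcc 0 ((n : ℝ) * (2 * Real.pi)) by
      rw [mem_uIcc]; right; constructor <;> nlinarith [Real.pi_pos])
    obtain ⟨m, hm⟩ := hper t ht
    exact (hodd m).2 (hm.symm.trans hv)
  · have h1 : (1 : ℝ) ≤ n := by exact_mod_cast hpos
    obtain ⟨t, ht, hv⟩ := hivt (show Real.pi ∈ uIcc 0 ((n : ℝ) * (2 * Real.pi)) by
      rw [mem_uIcc]; left; constructor <;> nlinarith [Real.pi_pos])
    obtain ⟨m, hm⟩ := hper t ht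
    exact (hodd m).1 (hm.symm.trans hv)

/-- The phases of the approximants converge to the continuous argument of the Gamma function. -/
theorem tendsto_gammaPhase {b t : ℝ} (hb : 0 < b) (ht : 0 ≤ t) :
    Tendsto (fun n => gammaPhase b n t) atTop (𝓝 (∫ u in 0..t, digamma (b + u * I)).re) := by
  obtain ⟨φ, hφ0, hφc, hφ⟩ := exists_tendsto_gammaPhase hb
  have hΘc : Continuous fun t : ℝ => (∫ u in 0..t, digamma (b + u * I)).re :=
    continuous_re.comp (intervalIntegral.continuous_primitive
      (fun a c => (continuous_digamma_vertical hb).intervalIntegrable a c) 0)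
  rw [← eq_of_exp_mul_I_eq ht (hφc t) hΘc.continuousOn (by simp [hφ0]) fun u hu => ?_]
  · exact hφ t ht
  · have h1 : Tendsto (fun n => GammaSeq (b + u * I) n) atTop
        (𝓝 (‖Gamma (b + u * I)‖ * exp (φ u * I))) := by
      have h2 : Tendsto (fun n => (‖GammaSeq (b + u * I) n‖ : ℂ) * exp (gammaPhase b n u * I)) atTop
          (𝓝 (‖Gamma (b + u * I)‖ * exp (φ u * I))) := by
        refine Tendsto.mul ?_ ?_
        · exact (continuous_ofReal.tendsto _).comp (GammaSeq_tendsto_Gamma _).norm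
        · exact (continuous_exp.tendsto _).comp
            (((continuous_ofReal.tendsto _).comp (hφ u hu.1)).mul_const I)
      refine h2.congr' ?_
      filter_upwards [eventually_ne_atTop 0] with n hn
      exact (hasPhase_GammaSeq hb u hn).symm
    have h3 := tendsto_nhds_unique h1 (GammaSeq_tendsto_Gamma _)
    rw [hasPhase_Gamma hb u] at h3
    have hne : (‖Gamma (b + u * I)‖ : ℂ) ≠ 0 := by
      simpa using Gamma_ne_zero_of_re_pos (s := b + u * I) (by simpa using hb)
    rw [← hasPhase_Gamma hb u] at h3
    exact mul_left_cancel₀ hne (h3.trans (hasPhase_Gamma hb u))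

/-- A primitive of `x ↦ arctan (t / x)`. -/
noncomputable def arctanPrimitive (t x : ℝ) : ℝ :=
  x * Real.arctan (t / x) + t / 2 * Real.log (x ^ 2 + t ^ 2)

theorem integral_arctan_div {t b c : ℝ} (hb : 0 < b) (hbc : b ≤ c) :
    ∫ x in b..c, Real.arctan (t / x) = arctanPrimitive t c - arctanPrimitive t b := by
  have hpos : ∀ x ∈ uIcc b c, 0 < x := fun x hx => by
    rw [uIcc_of_le hbc] at hx
    exact hb.trans_le hx.1
  refine intervalIntegral.integral_eq_sub_of_hasDerivAt (fun x hx => ?_)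
    (ContinuousOn.intervalIntegrable ?_)
  · have hx0 := hpos x hx
    have h1 : HasDerivAt (fun x : ℝ => t / x) (-t / x ^ 2) x := by
      simpa [div_eq_mul_inv, neg_mul] using (hasDerivAt_inv hx0.ne').const_mul t
    have h2 := (hasDerivAt_id x).mul h1.arctan
    have h3 := ((((hasDerivAt_pow 2 x).add_const (t ^ 2)).log (by positivity)).const_mul (t / 2))
    refine (h2.add h3).congr_deriv ?_
    have : x ^ 2 + t ^ 2 ≠ 0 := by positivity
    have h5 : 1 + (t / x) ^ 2 ≠ 0 := by positivity
    simp only [id_eq]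
    have h4 : 1 + (t / x) ^ 2 = (x ^ 2 + t ^ 2) / x ^ 2 := by field_simp
    rw [h4]
    field_simp
    push_cast
    ring
  · exact Real.continuous_arctan.comp_continuousOn
      (continuousOn_const.div continuousOn_id fun x hx => (hpos x hx).ne')

/-- As x ↦ arctan(t/x) decreases, the sum exceeds its integral by at most the first term, which is
below π/2. -/
theorem gammaPhase_bounds {b t : ℝ} (hb : 0 < b) (ht : 0 ≤ t) (n : ℕ) :
    t * Real.log n - arctanPrimitive t (b + (n + 1)) + arctanPrimitive t b - Real.pi / 2
        ≤ gammaPhase b n t ∧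
      gammaPhase b n t ≤ t * Real.log n - arctanPrimitive t (b + (n + 1)) + arctanPrimitive t b := by
  have hanti : AntitoneOn (fun x : ℝ => Real.arctan (t / x)) (Icc b (b + (n + 1 : ℕ))) := by
    intro x hx y hy hxy
    apply Real.arctan_mono
    have := hb.trans_le hx.1
    gcongr
  have h1 := hanti.integral_le_sum
  have h2 := hanti.sum_le_integral
  rw [integral_arctan_div hb (by simp; positivity)] at h1 h2
  have h3 := Finset.sum_range_sub' (fun k : ℕ => Real.arctan (t / (b + k))) (n + 1)
  rw [Finset.sum_sub_distrib] at h3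
  have h4 : 0 ≤ Real.arctan (t / (b + (n + 1 : ℕ))) := Real.arctan_nonneg.2 (by positivity)
  have h5 := Real.arctan_lt_pi_div_two (t / (b + (0 : ℕ)))
  unfold gammaPhase
  push_cast at *
  constructor <;> linarith

/-- At X = b+n+1 the primitive is t + t log X + o(1); the logarithm cancels t log n in the limit. -/
theorem tendsto_log_sub_arctanPrimitive {b t : ℝ} (hb : 0 < b) (ht : 0 ≤ t) :
    Tendsto (fun n : ℕ => t * Real.log n - arctanPrimitive t (b + (n + 1))) atTop (𝓝 (-t)) := by
  have hX : Tendsto (fun n : ℕ => b + ((n : ℝ) + 1)) atTop atTop :=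
    tendsto_atTop_add_const_left _ _ (tendsto_atTop_add_const_right _ _ tendsto_natCast_atTop_atTop)
  have h1 : Tendsto (fun n : ℕ => (b + ((n : ℝ) + 1)) * Real.arctan (t / (b + (n + 1)))) atTop
      (𝓝 t) := by
    have h2 : Tendsto (fun n : ℕ => t - t ^ 2 / (b + ((n : ℝ) + 1))) atTop (𝓝 t) := by
      simpa using (hX.const_div_atTop (t ^ 2)).const_sub t
    refine tendsto_of_tendsto_of_tendsto_of_le_of_le h2 tendsto_const_nhds (fun n => ?_) fun n => ?_
    · have hpos : 0 < b + ((n : ℝ) + 1) := by positivity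
      have := mul_le_mul_of_nonneg_left (sub_sq_le_arctan (y := t / (b + (n + 1))) (by positivity))
        hpos.le
      refine le_trans (le_of_eq ?_) this
      field_simp
    · have hpos : 0 < b + ((n : ℝ) + 1) := by positivity
      have := mul_le_mul_of_nonneg_left (arctan_le_of_nonneg (y := t / (b + (n + 1))) (by positivity))
        hpos.le
      refine this.trans (le_of_eq ?_)
      field_simp
  have h3 : Tendsto (fun n : ℕ => Real.log ((1 + (b + 1) / n) ^ 2 + (t / n) ^ 2)) atTop (𝓝 0) := by
    have : Tendsto (fun n : ℕ => (1 + (b + 1) / (n : ℝ)) ^ 2 + (t / n) ^ 2) atTop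
        (𝓝 ((1 + 0) ^ 2 + 0 ^ 2)) :=
      (((tendsto_const_div_atTop_nhds_zero_nat (b + 1)).const_add 1).pow 2).add
        ((tendsto_const_div_atTop_nhds_zero_nat t).pow 2)
    have h := (Real.continuousAt_log (x := (1 + 0) ^ 2 + 0 ^ 2) (by norm_num)).tendsto.comp this
    simpa [Function.comp_def] using h
  have h4 := (h1.add (h3.const_mul (t / 2))).neg
  rw [mul_zero, add_zero] at h4
  refine h4.congr' ?_
  filter_upwards [eventually_gt_atTop 0] with n hn
  have hn' : (0 : ℝ) < n := by exact_mod_cast hn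
  have h5 : (1 + (b + 1) / (n : ℝ)) ^ 2 + (t / n) ^ 2 = ((b + (n + 1)) ^ 2 + t ^ 2) / n ^ 2 := by
    field_simp
    ring
  rw [h5, Real.log_div (by positivity) (by positivity), Real.log_pow, arctanPrimitive]
  push_cast
  ring

/-- Stirling's formula for the argument of the Gamma function on a vertical line. -/
theorem abs_re_integral_digamma_sub_le {b : ℝ} (hb : 0 < b) {t : ℝ} (ht : 1 ≤ t) :
    |(∫ u in 0..t, digamma (b + u * I)).re - (t * Real.log t - t)|
      ≤ Real.pi / 2 + b * (Real.pi / 2) + b ^ 2 / 2 := by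
  have ht0 : 0 < t := by linarith
  have h1 := tendsto_gammaPhase hb ht0.le
  have h2 := (tendsto_log_sub_arctanPrimitive hb ht0.le).add_const (arctanPrimitive t b)
  have hu := le_of_tendsto_of_tendsto' h1 h2 fun n => (gammaPhase_bounds hb ht0.le n).2
  have hl := le_of_tendsto_of_tendsto' (h2.sub_const (Real.pi / 2)) h1
    fun n => (gammaPhase_bounds hb ht0.le n).1
  have ha0 : 0 ≤ b * Real.arctan (t / b) :=
    mul_nonneg hb.le (Real.arctan_nonneg.2 (by positivity))
  have ha1 : b * Real.arctan (t / b) ≤ b * (Real.pi / 2) := by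
    gcongr
    exact (Real.arctan_lt_pi_div_two _).le
  -- The term (t/2) log(b² + t²) at the lower endpoint b is the source of t log t; what remains is
  -- at most b²/2 because t ≥ 1.
  have hlog : Real.log (b ^ 2 + t ^ 2) = 2 * Real.log t + Real.log (1 + (b / t) ^ 2) := by
    have : b ^ 2 + t ^ 2 = t ^ 2 * (1 + (b / t) ^ 2) := by
      field_simp
      ring
    rw [this, Real.log_mul (by positivity) (by positivity), Real.log_pow]
    push_cast
    ring
  have hl0 : 0 ≤ t / 2 * Real.log (1 + (b / t) ^ 2) :=
    mul_nonneg (by positivity) (Real.log_nonneg (by linarith [sq_nonneg (b / t)]))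
  have hl1 : t / 2 * Real.log (1 + (b / t) ^ 2) ≤ b ^ 2 / 2 := by
    have h3 : Real.log (1 + (b / t) ^ 2) ≤ (b / t) ^ 2 := by
      refine (Real.log_le_sub_one_of_pos (by positivity)).trans (le_of_eq (by ring))
    calc t / 2 * Real.log (1 + (b / t) ^ 2) ≤ t / 2 * (b / t) ^ 2 := by gcongr
      _ = b ^ 2 / 2 * (1 / t) := by field_simp
      _ ≤ b ^ 2 / 2 * 1 := by
        gcongr
        rw [div_le_one ht0]
        exact ht
      _ = b ^ 2 / 2 := mul_one _
  simp only [arctanPrimitive, hlog] at hu hl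
  rw [abs_le]
  constructor <;> nlinarith [Real.pi_pos]

/-! ### Dirichlet series: growth in the strip and the line re s = 2. -/

/-- Continuation to `0 < re s` and bound there, for a Dirichlet series whose coefficients have
partial sums `κ t + O(1)`. -/
theorem norm_le_of_norm_sum_sub_le {a : ℕ → ℂ} {F : ℂ → ℂ} {κ : ℂ} {C : ℝ}
    (hF : DifferentiableOn ℂ F {s | 0 < s.im}) (hL : ∀ s, 1 < s.re → F s = LSeries a s)
    (ha : ∀ n, ‖a n‖ ≤ 1)
    (hsum : ∀ t : ℝ, 1 ≤ t → ‖∑ k ∈ Finset.Icc 1 ⌊t⌋₊, a k - κ * t‖ ≤ C) {s : ℂ}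
    (hre : 0 < s.re) (him : 0 < s.im) :
    ‖F s‖ ≤ ‖s‖ * (‖κ‖ / ‖s - 1‖ + C / s.re) := by
  set A : ℝ → ℂ := fun t => ∑ k ∈ Finset.Icc 1 ⌊t⌋₊, a k with hA
  set E : ℝ → ℂ := fun t => A t - κ * t with hE
  have hAm : Measurable A :=
    (measurable_from_nat (f := fun n : ℕ => ∑ k ∈ Finset.Icc 1 n, a k)).comp Nat.measurable_floor
  have hEm : Measurable E := hAm.sub (measurable_const.mul measurable_ofReal)
  have hEb : ∀ t ∈ Ioi (1 : ℝ), ‖E t‖ ≤ C := fun t ht => hsum t (le_of_lt ht)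
  have hC : 0 ≤ C := (norm_nonneg _).trans (hsum 1 le_rfl)
  have hpow_meas : ∀ z : ℂ, Measurable fun t : ℝ => (t : ℂ) ^ z := fun z => by fun_prop
  have hdom : ∀ z : ℂ, 0 < z.re → MeasureTheory.IntegrableOn
      (fun t : ℝ => C * t ^ (-(z.re + 1))) (Ioi 1) := fun z hz =>
    (integrableOn_Ioi_rpow_of_lt (by linarith) one_pos).const_mul C
  have hle : ∀ z : ℂ, ∀ t ∈ Ioi (1 : ℝ), ‖E t * (t : ℂ) ^ (-(z + 1))‖ ≤ C * t ^ (-(z.re + 1)) :=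
    fun z t ht => by
      have ht0 : (0 : ℝ) < t := one_pos.trans ht
      rw [norm_mul, norm_cpow_eq_rpow_re_of_pos ht0]
      simp only [neg_re, add_re, one_re]
      gcongr
      exact hEb t ht
  have hEint : ∀ z : ℂ, 0 < z.re → MeasureTheory.IntegrableOn
      (fun t : ℝ => E t * (t : ℂ) ^ (-(z + 1))) (Ioi 1) := fun z hz =>
    (hdom z hz).mono' (hEm.mul (hpow_meas _)).aestronglyMeasurable
      ((MeasureTheory.ae_restrict_iff' measurableSet_Ioi).2 (Eventually.of_forall (hle z)))
  set M : ℂ → ℂ := fun z => ∫ t in Ioi (1 : ℝ), E t * (t : ℂ) ^ (-(z + 1)) with hM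
  -- Writing the integral as a Mellin transform of the error term, cut off below 1, gives its
  -- holomorphy in re z > 0.
  have hMmellin : M = fun z => mellin ((Ioi 1).indicator E) (-z) := by
    ext z
    change ∫ t in Ioi (1 : ℝ), E t * (t : ℂ) ^ (-(z + 1)) = _
    rw [mellin, ← MeasureTheory.integral_indicator measurableSet_Ioi,
      ← MeasureTheory.integral_indicator measurableSet_Ioi]
    congr 1
    ext t
    by_cases ht : t ∈ Ioi (1 : ℝ)
    · have ht0 : t ∈ Ioi (0 : ℝ) := mem_Ioi.2 (one_pos.trans ht)
      rw [indicator_of_mem ht, indicator_of_mem ht0, indicator_of_mem ht, smul_eq_mul, mul_comm]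
      congr 2
      ring
    · by_cases ht0 : t ∈ Ioi (0 : ℝ)
      · rw [indicator_of_notMem ht, indicator_of_mem ht0, indicator_of_notMem ht, smul_zero]
      · rw [indicator_of_notMem ht, indicator_of_notMem ht0]
  have hMdiff : ∀ z : ℂ, 0 < z.re → DifferentiableAt ℂ M z := fun z hz => by
    rw [hMmellin]
    refine DifferentiableAt.fun_comp' (f := fun z : ℂ => -z) (g := mellin ((Ioi 1).indicator E)) z
      ?_ differentiableAt_id.neg
    have hind : ∀ t, ‖(Ioi 1).indicator E t‖ ≤ C := fun t => by
      by_cases ht : t ∈ Ioi (1 : ℝ)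
      · rw [indicator_of_mem ht]; exact hEb t ht
      · rw [indicator_of_notMem ht, norm_zero]; exact hC
    -- The function is bounded at infinity, hence a = 0. Near 0 it vanishes, so any exponent b below
    -- re(-z) serves.
    refine mellin_differentiableAt_of_isBigO_rpow (a := 0) (b := -z.re - 1) ?_ ?_
      (by simpa using hz) ?_ (by simp)
    · refine MeasureTheory.LocallyIntegrable.locallyIntegrableOn ?_ _
      refine (MeasureTheory.locallyIntegrable_const C).mono
        (hEm.indicator measurableSet_Ioi).aestronglyMeasurable (Eventually.of_forall fun t => ?_)
      rw [Real.norm_of_nonneg hC]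
      exact hind t
    · refine Asymptotics.IsBigO.of_bound C (Eventually.of_forall fun t => ?_)
      simpa using hind t
    · refine Asymptotics.IsBigO.of_bound 0 ?_
      filter_upwards [nhdsWithin_le_nhds (Iio_mem_nhds (zero_lt_one' ℝ))] with t ht
      rw [indicator_of_notMem (by simpa using ht.le)]
      simp
  -- Abel summation: the main term κt integrates to κ/(z-1) and the bounded error to `M`. The
  -- identity theorem then carries F = G from re z > 1 to the whole open first quadrant, which
  -- avoids a possible pole at 1.
  set G : ℂ → ℂ := fun z => z * (κ / (z - 1) + M z) with hG
  have hFG : ∀ z : ℂ, 1 < z.re → F z = G z := fun z hz => by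
    rw [hL z hz, LSeries_eq_mul_integral a zero_le_one hz
      (LSeriesSummable_of_bounded_of_one_lt_re (fun n _ => ha n) hz) ?_]
    · have h1 : ∀ t ∈ Ioi (1 : ℝ), (∑ k ∈ Finset.Icc 1 ⌊t⌋₊, a k) * (t : ℂ) ^ (-(z + 1))
          = κ * (t : ℂ) ^ (-z) + E t * (t : ℂ) ^ (-(z + 1)) := fun t ht => by
        have ht0 : (t : ℂ) ≠ 0 := by exact_mod_cast (one_pos.trans ht).ne'
        have : (t : ℂ) ^ (-z) = t * (t : ℂ) ^ (-(z + 1)) := by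
          rw [show -z = 1 + -(z + 1) by ring, cpow_add _ _ ht0, cpow_one]
        rw [this, hE]
        ring
      rw [MeasureTheory.setIntegral_congr_fun measurableSet_Ioi h1, MeasureTheory.integral_add
        ((integrableOn_Ioi_cpow_of_lt (by simpa using hz) one_pos).const_mul κ)
        (hEint z (by linarith)), MeasureTheory.integral_const_mul,
        integral_Ioi_cpow_of_lt (by simpa using hz) one_pos, hG]
      simp only [ofReal_one, one_cpow]
      rw [show -z + 1 = -(z - 1) by ring, neg_div_neg_eq, mul_one_div]
    · refine Asymptotics.IsBigO.of_bound 1 (Eventually.of_forall fun n => ?_)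
      rw [Real.rpow_one, one_mul, Real.norm_natCast]
      refine (norm_sum_le _ _).trans ((Finset.sum_le_sum fun k _ => ha k).trans ?_)
      simp
  have hFGs : F s = G s := by
    have hopen : IsOpen {z : ℂ | 0 < z.re ∧ 0 < z.im} :=
      isOpen_re_pos.inter (isOpen_lt continuous_const continuous_im)
    have hconv : Convex ℝ {z : ℂ | 0 < z.re ∧ 0 < z.im} :=
      (convex_halfSpace_re_gt 0).inter (convex_halfSpace_im_gt 0)
    have h1 : AnalyticOnNhd ℂ F {z : ℂ | 0 < z.re ∧ 0 < z.im} :=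
      (hF.mono fun z hz => hz.2).analyticOnNhd hopen
    have h2 : AnalyticOnNhd ℂ G {z : ℂ | 0 < z.re ∧ 0 < z.im} := by
      refine DifferentiableOn.analyticOnNhd (fun z hz => ?_) hopen
      have hz1 : z - 1 ≠ 0 := fun h => by
        have := congrArg im h
        simp at this
        exact hz.2.ne' this
      have := hMdiff z hz.1
      exact DifferentiableAt.differentiableWithinAt (by fun_prop (disch := exact hz1))
    refine h1.eqOn_of_preconnected_of_eventuallyEq h2 hconv.isPreconnected
      (z₀ := 2 + I) (by simp) ?_ ⟨hre, him⟩
    filter_upwards [(isOpen_lt continuous_const continuous_re).mem_nhds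
      (show (1 : ℝ) < (2 + I : ℂ).re by simp)] with z hz
    exact hFG z hz
  have hMle : ‖M s‖ ≤ C / s.re := by
    refine (MeasureTheory.norm_integral_le_of_norm_le (hdom s hre)
      ((MeasureTheory.ae_restrict_iff' measurableSet_Ioi).2
        (Eventually.of_forall (hle s)))).trans (le_of_eq ?_)
    rw [MeasureTheory.integral_const_mul, integral_Ioi_rpow_of_lt (by linarith) one_pos,
      Real.one_rpow]
    rw [show -(s.re + 1) + 1 = -s.re by ring, neg_div_neg_eq, mul_one_div]
  rw [hFGs, hG, norm_mul]
  gcongr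
  refine (norm_add_le _ _).trans ?_
  rw [norm_div]
  gcongr

/-- The terms with n ≥ 2 sum to at most π²/6 - 1, which is just below 2/3. A bound below 1 keeps the
values in the right half-plane, where the principal logarithm is available. -/
theorem norm_LSeries_sub_one_le {a : ℕ → ℂ} (ha : ∀ n, ‖a n‖ ≤ 1) (h1 : a 1 = 1) {s : ℂ}
    (hs : s.re = 2) : ‖LSeries a s - 1‖ ≤ 2 / 3 := by
  have hsum := LSeriesSummable_of_bounded_of_one_lt_re (fun n _ => ha n)
    (show 1 < s.re by rw [hs]; norm_num)
  have h2 : LSeries a s - 1 = ∑' n, (LSeries.term a s n - if n = 1 then 1 else 0) := by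
    rw [Summable.tsum_sub hsum (hasSum_ite_eq 1 1).summable, tsum_ite_eq]
    rfl
  have h3 := hasSum_zeta_two.sub (hasSum_ite_eq 1 (1 : ℝ))
  rw [h2]
  refine (tsum_of_norm_bounded h3 fun n => ?_).trans ?_
  · rcases eq_or_ne n 1 with rfl | hn
    · simp [h1]
    · rw [if_neg hn, if_neg hn, sub_zero, sub_zero, LSeries.norm_term_eq]
      split_ifs with h0
      · simp [h0]
      · rw [hs, Real.rpow_two]
        gcongr
        exact ha n
  · nlinarith [Real.pi_lt_d2, Real.pi_pos]

/-- The variation of a logarithm along a segment of the line `re s = 2`, for a function that stays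
close to `1`. -/
theorem abs_re_integral_logDeriv_le {F : ℂ → ℂ} (hF : DifferentiableOn ℂ F {s | 0 < s.im})
    (h : ∀ s : ℂ, s.re = 2 → ‖F s - 1‖ ≤ 2 / 3) {t₀ T : ℝ} (ht₀ : 0 < t₀) (hT : t₀ ≤ T) :
    |(∫ y in t₀..T, logDeriv F ((2 : ℝ) + y * I)).re| ≤ 2 * Real.pi := by
  have hopen : IsOpen {s : ℂ | 0 < s.im} := isOpen_lt continuous_const continuous_im
  have han := hF.analyticOnNhd hopen
  have hslit : ∀ s : ℂ, s.re = 2 → F s ∈ slitPlane := fun s hs => by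
    left
    have := (abs_re_le_norm (F s - 1)).trans (h s hs)
    rw [sub_re, one_re, abs_le] at this
    linarith [this.1]
  have hline : ∀ z ∈ {z : ℂ | z.re = 2 ∧ z.im ∈ Icc t₀ T}, 0 < z.im := fun z hz =>
    ht₀.trans_le hz.2.1
  have h1 := integral_vertical_eq_sub (F := logDeriv F) (G := fun s => log (F s)) (x := 2) hT
    (fun y hy => by
      have him : 0 < (((2 : ℝ) : ℂ) + y * I).im := by simpa using ht₀.trans_le hy.1
      have := (han _ him).differentiableAt.hasDerivAt.clog (hslit _ (by simp))
      rwa [logDeriv_apply])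
    (fun z hz => ((han z (hline z hz)).deriv.continuousAt.div
      (han z (hline z hz)).continuousAt
      (slitPlane_ne_zero (hslit z hz.1))).continuousWithinAt)
  have h2 := congrArg im h1
  rw [I_mul_im, sub_im, log_im, log_im] at h2
  rw [h2]
  refine (abs_sub _ _).trans ?_
  linarith [abs_arg_le_pi (F ((2 : ℝ) + T * I)), abs_arg_le_pi (F ((2 : ℝ) + t₀ * I))]

/-! ### The Riemann–von Mangoldt formula for a completed function. -/

theorem finite_zeroMultiplicity_pos {Λ : ℂ → ℂ} (hΛ : ∀ z, MeromorphicAt Λ z) {K : Set ℂ}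
    (hK : IsCompact K) : {s ∈ K | 0 < zeroMultiplicity Λ s}.Finite := by
  refine ((MeromorphicOn.divisor Λ K).finiteSupport hK).subset fun s hs h => ?_
  have hs2 := hs.2
  rw [MeromorphicOn.divisor_apply (fun z _ => hΛ z) hs.1] at h
  rw [zeroMultiplicity, h] at hs2
  simp at hs2

theorem isCompact_criticalRectangle (T : ℝ) : IsCompact (criticalRectangle T) := by
  have : criticalRectangle T = closedRect 0 1 0 T := by
    ext s
    simp only [criticalRectangle, mem_ofPred_eq, mem_closedRect, and_assoc]
  rw [this]
  exact isCompact_closedRect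

/-- `Λ` is `f` completed by the factor `exp (e s) Γ (α s + β)`, with a functional equation that
relates `s` to `1 - conj s`, and with the growth conditions needed for counting its zeros. -/
structure IsCompletion (Λ f : ℂ → ℂ) (e α β : ℝ) : Prop where
  pos : 0 < α
  nonneg : 0 ≤ β
  meromorphicAt : ∀ z, MeromorphicAt Λ z
  eq : ∀ s : ℂ, 0 < s.im → Λ s = exp (e * s) * Gamma (α * s + β) * f s
  differentiableOn : DifferentiableOn ℂ f {s | 0 < s.im}
  symm : ∃ w : ℂ, ∀ s : ℂ, 0 < s.im → Λ (1 - (starRingEnd ℂ) s) = w * (starRingEnd ℂ) (Λ s)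
  ne_zero : ∀ s : ℂ, 0 < s.im → 1 < s.re → f s ≠ 0
  -- The range contains the discs of radius 15/8 about 2+iT, T ≥ 4, used for Backlund's bound; 1/8 =
  -- 2 - 15/8.
  bound : ∃ C : ℝ, ∃ k : ℕ, 0 < C ∧ ∀ s : ℂ, 1 / 8 ≤ s.re → s.re ≤ 4 → 1 ≤ s.im →
    ‖f s‖ ≤ C * s.im ^ k
  lower : ∃ m : ℝ, 0 < m ∧ ∀ t : ℝ, 0 < t → m ≤ ‖f (2 + t * I)‖
  arg : ∃ C : ℝ, ∀ t₀ T : ℝ, 0 < t₀ → t₀ ≤ T →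
    |(∫ y in t₀..T, logDeriv f ((2 : ℝ) + y * I)).re| ≤ C

theorem intervalIntegral_conj (F : ℝ → ℂ) (a b : ℝ) :
    ∫ x in a..b, (starRingEnd ℂ) (F x) = (starRingEnd ℂ) (∫ x in a..b, F x) := by
  simp only [intervalIntegral, integral_conj, map_sub]

theorem isOpen_im_pos : IsOpen {s : ℂ | 0 < s.im} := isOpen_lt continuous_const continuous_im

namespace IsCompletion

variable {Λ f : ℂ → ℂ} {e α β : ℝ}

theorem analyticAt_gamma (h : IsCompletion Λ f e α β) {s : ℂ} (hs : 0 < s.im) :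
    DifferentiableAt ℂ Gamma (α * s + β) :=
  differentiableAt_Gamma _ fun m hm => by
    have := congrArg im hm
    simp [h.pos.ne', hs.ne'] at this

theorem analyticOnNhd (h : IsCompletion Λ f e α β) : AnalyticOnNhd ℂ Λ {s | 0 < s.im} := by
  refine DifferentiableOn.analyticOnNhd (DifferentiableOn.congr (fun s hs => ?_) h.eq) isOpen_im_pos
  have h1 : DifferentiableAt ℂ (fun s : ℂ => Gamma (α * s + β)) s :=
    DifferentiableAt.fun_comp' (f := fun s : ℂ => α * s + β) s (h.analyticAt_gamma hs)
      (by fun_prop)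
  have h2 : DifferentiableAt ℂ (fun s : ℂ => exp (e * s)) s := by fun_prop
  exact ((h2.mul h1).differentiableWithinAt).mul (h.differentiableOn s hs)

theorem re_pos (h : IsCompletion Λ f e α β) {s : ℂ} (hs : 0 < s.re) :
    0 < (α * s + β : ℂ).re := by
  have := h.pos
  have := h.nonneg
  simp
  positivity

theorem eq_zero_iff (h : IsCompletion Λ f e α β) {s : ℂ} (him : 0 < s.im) (hre : 0 < s.re) :
    Λ s = 0 ↔ f s = 0 := by
  rw [h.eq s him, mul_eq_zero, mul_eq_zero]
  simp [Gamma_ne_zero_of_re_pos (h.re_pos hre)]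

theorem ne_zero_of_one_lt_re (h : IsCompletion Λ f e α β) {s : ℂ} (him : 0 < s.im)
    (hre : 1 < s.re) : Λ s ≠ 0 :=
  (h.eq_zero_iff him (by linarith)).not.2 (h.ne_zero s him hre)

theorem exists_symm (h : IsCompletion Λ f e α β) : ∃ w : ℂ, w ≠ 0 ∧ ∀ s : ℂ, 0 < s.im →
    Λ (1 - (starRingEnd ℂ) s) = w * (starRingEnd ℂ) (Λ s) := by
  obtain ⟨w, hw⟩ := h.symm
  refine ⟨w, fun h0 => ?_, hw⟩
  -- The point -1+i is reflected to 2+i, where Λ does not vanish.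
  have h1 := hw (-1 + I) (by simp)
  rw [h0, zero_mul] at h1
  exact h.ne_zero_of_one_lt_re (by simp) (by simp) h1

theorem re_mem_of_eq_zero (h : IsCompletion Λ f e α β) {s : ℂ} (him : 0 < s.im) (h0 : Λ s = 0) :
    0 ≤ s.re ∧ s.re ≤ 1 := by
  constructor
  · by_contra hneg
    obtain ⟨w, -, hw⟩ := h.exists_symm
    have h1 := hw s him
    rw [h0, map_zero, mul_zero] at h1
    exact h.ne_zero_of_one_lt_re (by simpa using him) (by simp; linarith) h1
  · by_contra hlt
    exact h.ne_zero_of_one_lt_re him (by linarith) h0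

theorem meromorphicOrderAt_ne_top (h : IsCompletion Λ f e α β) (z : ℂ) :
    meromorphicOrderAt Λ z ≠ ⊤ := by
  have him : 0 < (2 + I : ℂ).im := by simp
  have h1 : meromorphicOrderAt Λ (2 + I) = 0 :=
    (h.analyticOnNhd _ him).meromorphicNFAt.meromorphicOrderAt_eq_zero_iff.2
      (h.ne_zero_of_one_lt_re him (by simp))
  exact MeromorphicOn.meromorphicOrderAt_ne_top_of_isPreconnected (U := univ)
    (fun z _ => h.meromorphicAt z) isPreconnected_univ (mem_univ (2 + I)) (mem_univ z)
    (by simp [h1])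

theorem zeroMultiplicity_pos_iff (h : IsCompletion Λ f e α β) {s : ℂ} (him : 0 < s.im) :
    0 < zeroMultiplicity Λ s ↔ Λ s = 0 := by
  have han := h.analyticOnNhd s him
  have h1 := han.meromorphicNFAt.meromorphicOrderAt_eq_zero_iff
  have h2 := han.meromorphicOrderAt_nonneg
  have h3 := h.meromorphicOrderAt_ne_top s
  rw [← not_iff_not, ← ne_eq (Λ s), ← h1, zeroMultiplicity]
  lift meromorphicOrderAt Λ s to ℤ using h3 with n
  rw [WithTop.untop₀_coe]
  norm_cast at h2 ⊢
  omega

/-- Logarithmic differentiation of the functional equation removes w; the sign comes from the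
reflection z ↦ 1 - z. -/
theorem logDeriv_symm (h : IsCompletion Λ f e α β) {s : ℂ} (him : 0 < s.im) :
    logDeriv Λ (1 - (starRingEnd ℂ) s) = -(starRingEnd ℂ) (logDeriv Λ s) := by
  obtain ⟨w, hw0, hw⟩ := h.exists_symm
  have him' : 0 < (1 - (starRingEnd ℂ) s).im := by simpa using him
  have h1 : HasDerivAt (fun z => Λ (1 - z)) (deriv Λ (1 - (starRingEnd ℂ) s) * -1)
      ((starRingEnd ℂ) s) :=
    (h.analyticOnNhd _ him').differentiableAt.hasDerivAt.comp _
      ((hasDerivAt_id ((starRingEnd ℂ) s)).const_sub 1)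
  have h2 := (h.analyticOnNhd s him).differentiableAt.hasDerivAt.conj_conj.const_mul w
  have h3 : (fun z => Λ (1 - z)) =ᶠ[𝓝 ((starRingEnd ℂ) s)]
      fun z => w * (starRingEnd ℂ) (Λ ((starRingEnd ℂ) z)) := by
    have : {z : ℂ | z.im < 0} ∈ 𝓝 ((starRingEnd ℂ) s) :=
      (isOpen_lt continuous_im continuous_const).mem_nhds (by simpa using him)
    filter_upwards [this] with z hz
    have := hw ((starRingEnd ℂ) z) (by simpa using hz)
    rwa [conj_conj] at this
  have h4 := (h2.congr_of_eventuallyEq h3).unique h1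
  rw [logDeriv_apply, logDeriv_apply, hw s him, map_div₀]
  have h5 : deriv Λ (1 - (starRingEnd ℂ) s) = -(w * (starRingEnd ℂ) (deriv Λ s)) := by
    rw [h4]; ring
  rw [h5, neg_div, mul_div_mul_left _ _ hw0]

/-- The logarithmic derivative of the factor that completes `f`. -/
noncomputable def logDerivFactor (e α β : ℝ) (s : ℂ) : ℂ := e + α * digamma (α * s + β)

theorem logDeriv_eq (h : IsCompletion Λ f e α β) {s : ℂ} (him : 0 < s.im) (hre : 0 < s.re)
    (h0 : f s ≠ 0) : logDeriv Λ s = logDerivFactor e α β s + logDeriv f s := by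
  have h1 : Λ =ᶠ[𝓝 s] fun s => exp (e * s) * Gamma (α * s + β) * f s := by
    filter_upwards [isOpen_im_pos.mem_nhds him] with z hz
    exact h.eq z hz
  have h2 : logDeriv Λ s = logDeriv (fun s => exp (e * s) * Gamma (α * s + β) * f s) s := by
    simp only [logDeriv_apply, h1.deriv_eq, h1.eq_of_nhds]
  have hΓ := Gamma_ne_zero_of_re_pos (h.re_pos hre)
  have hd1 : HasDerivAt (fun s : ℂ => Gamma (α * s + β)) (deriv Gamma (α * s + β) * α) s := by
    have := ((hasDerivAt_id s).const_mul (α : ℂ)).add_const (β : ℂ)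
    simpa [Function.comp_def] using (h.analyticAt_gamma him).hasDerivAt.comp s this
  have hd2 : HasDerivAt (fun s : ℂ => exp (e * s)) (exp (e * s) * e) s := by
    simpa using ((hasDerivAt_id s).const_mul (e : ℂ)).cexp
  have hdf : DifferentiableAt ℂ f s := h.differentiableOn.differentiableAt
    (isOpen_im_pos.mem_nhds him)
  rw [h2, logDeriv_mul (f := fun s => exp (e * s) * Gamma (α * s + β)) s
    (mul_ne_zero (exp_ne_zero _) hΓ) h0 (hd2.mul hd1).differentiableAt hdf,
    logDeriv_mul (f := fun s => exp (e * s)) (g := fun s : ℂ => Gamma (α * s + β)) s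
      (exp_ne_zero _) hΓ hd2.differentiableAt hd1.differentiableAt,
    logDeriv_apply (fun s => exp (e * s)), hd2.deriv,
    logDeriv_apply (fun s : ℂ => Gamma (α * s + β)), hd1.deriv, logDerivFactor, digamma_def,
    logDeriv_apply Gamma, mul_div_cancel_left₀ _ (exp_ne_zero _)]
  ring

theorem differentiableOn_logDerivFactor (h : IsCompletion Λ f e α β) :
    DifferentiableOn ℂ (logDerivFactor e α β) {s | 0 < s.re} := fun s hs => by
  have h1 := (differentiableOn_digamma.differentiableAt
    (isOpen_re_pos.mem_nhds (h.re_pos hs)))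
  have h2 : DifferentiableAt ℂ (fun s : ℂ => digamma (α * s + β)) s :=
    DifferentiableAt.fun_comp' (f := fun s : ℂ => α * s + β) s h1 (by fun_prop)
  exact ((h2.const_mul _).const_add _).differentiableWithinAt

theorem continuousAt_logDeriv (h : IsCompletion Λ f e α β) {s : ℂ} (him : 0 < s.im)
    (h0 : f s ≠ 0) : ContinuousAt (logDeriv f) s :=
  have han := h.differentiableOn.analyticAt (isOpen_im_pos.mem_nhds him)
  han.deriv.continuousAt.div han.continuousAt h0

theorem continuousAt_logDeriv_completion (h : IsCompletion Λ f e α β) {s : ℂ} (him : 0 < s.im)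
    (h0 : Λ s ≠ 0) : ContinuousAt (logDeriv Λ) s :=
  have han := h.analyticOnNhd s him
  han.deriv.continuousAt.div han.continuousAt h0

/-- The reflection x ↦ 1 - x exchanges [-1,½] and [½,2] and turns Λ'/Λ into minus its conjugate, so
both halves have the same imaginary part. -/
theorem im_integral_horizontal (h : IsCompletion Λ f e α β) {y : ℝ} (hy : 0 < y)
    (h0 : ∀ s : ℂ, s.im = y → Λ s ≠ 0) :
    (∫ x in (-1 : ℝ)..2, logDeriv Λ (x + y * I)).im
      = 2 * (∫ x in (1 / 2 : ℝ)..2, logDeriv Λ (x + y * I)).im := by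
  have hint : ∀ a b : ℝ, IntervalIntegrable (fun x : ℝ => logDeriv Λ (x + y * I))
      MeasureTheory.volume a b := fun a b => by
    refine Continuous.intervalIntegrable (continuous_iff_continuousAt.2 fun x => ?_) _ _
    exact ContinuousAt.comp' (f := fun x : ℝ => (x + y * I : ℂ))
      (h.continuousAt_logDeriv_completion (by simpa using hy) (h0 _ (by simp))) (by fun_prop)
  rw [← intervalIntegral.integral_add_adjacent_intervals (hint (-1) (1 / 2)) (hint (1 / 2) 2)]
  have h1 := intervalIntegral.integral_comp_sub_left (a := 1 / 2) (b := 2)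
    (fun x : ℝ => logDeriv Λ (x + y * I)) 1
  norm_num at h1
  have h2 : ∀ x : ℝ, logDeriv Λ (1 - x + y * I) = -(starRingEnd ℂ) (logDeriv Λ (x + y * I)) :=
    fun x => by
      rw [← h.logDeriv_symm (by simpa using hy)]
      congr 1
      simp
      ring
  have h3 : (∫ x in (-1 : ℝ)..(1 / 2), logDeriv Λ (x + y * I)).im
      = (∫ x in (1 / 2 : ℝ)..2, logDeriv Λ (x + y * I)).im := by
    norm_num
    rw [← h1]
    simp only [h2]
    rw [intervalIntegral.integral_neg, intervalIntegral_conj, neg_im, conj_im, neg_neg]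
  rw [add_im, h3]
  ring

theorem re_integral_vertical (h : IsCompletion Λ f e α β) {t₀ T : ℝ} (ht₀ : 0 < t₀)
    (hT : t₀ ≤ T) :
    (∫ y in t₀..T, logDeriv Λ ((-1 : ℝ) + y * I)).re
      = -(∫ y in t₀..T, logDeriv Λ ((2 : ℝ) + y * I)).re := by
  have h2 : ∀ y ∈ uIcc t₀ T, logDeriv Λ ((-1 : ℝ) + y * I)
      = -(starRingEnd ℂ) (logDeriv Λ ((2 : ℝ) + y * I)) := fun y hy => by
    rw [uIcc_of_le hT] at hy
    rw [← h.logDeriv_symm (by simpa using ht₀.trans_le hy.1)]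
    congr 1
    simp only [map_add, map_mul, conj_ofReal, conj_I]
    push_cast
    ring
  rw [intervalIntegral.integral_congr h2, intervalIntegral.integral_neg,
    intervalIntegral_conj, neg_re, conj_re]

/-- Riemann's formula for the number of zeros between two horizontal lines without zeros. -/
theorem pi_mul_count_eq (h : IsCompletion Λ f e α β) {t₀ T : ℝ} (ht₀ : 0 < t₀) (hT : t₀ < T)
    (h1 : ∀ s : ℂ, s.im = t₀ → Λ s ≠ 0) (h2 : ∀ s : ℂ, s.im = T → Λ s ≠ 0) :
    Real.pi * (∑ᶠ u ∈ closedRect (-1) 2 t₀ T, zeroMultiplicity Λ u : ℕ)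
      = (∫ x in (1 / 2 : ℝ)..2, logDeriv Λ (x + t₀ * I)).im
        - (∫ x in (1 / 2 : ℝ)..2, logDeriv Λ (x + T * I)).im
        + (∫ y in t₀..T, logDeriv Λ ((2 : ℝ) + y * I)).re := by
  have him : ∀ s ∈ closedRect (-1) 2 t₀ T, 0 < s.im := fun s hs => ht₀.trans_le hs.2.1
  have harg := rectIntegral_logDeriv (f := Λ) (a := -1) (b := 2) (by norm_num) hT
    (fun s hs => h.analyticOnNhd s (him s hs)) (fun s hs h0 => by
      have := h.re_mem_of_eq_zero (him s hs.1) h0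
      rcases hs.2 with h3 | h3 | h3 | h3
      · linarith
      · linarith
      · exact h1 s h3 h0
      · exact h2 s h3 h0)
  have h3 := congrArg im harg
  rw [rectIntegral] at h3
  simp only [sub_im, add_im, I_mul_im] at h3
  rw [h.im_integral_horizontal ht₀ h1, h.im_integral_horizontal (ht₀.trans hT) h2,
    h.re_integral_vertical ht₀ hT.le] at h3
  have h4 : (2 * Real.pi * I * (∑ᶠ u ∈ closedRect (-1) 2 t₀ T, zeroMultiplicity Λ u : ℕ) : ℂ).im
      = 2 * (Real.pi * (∑ᶠ u ∈ closedRect (-1) 2 t₀ T, zeroMultiplicity Λ u : ℕ)) := by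
    rw [show (2 * Real.pi * I * (∑ᶠ u ∈ closedRect (-1) 2 t₀ T, zeroMultiplicity Λ u : ℕ) : ℂ)
      = I * ((2 * (Real.pi * (∑ᶠ u ∈ closedRect (-1) 2 t₀ T, zeroMultiplicity Λ u : ℕ)) : ℝ) : ℂ) by
        push_cast; ring, I_mul_im, ofReal_re]
  rw [h4] at h3
  linarith

/-- The factor is holomorphic for re s > 0, so by Cauchy the path may be replaced by the segment on
re s = ½. There αs+β runs along the line of real part α/2+β, and the integral is an argument of Γ.
-/
theorem re_integral_logDerivFactor (h : IsCompletion Λ f e α β) {t₀ T : ℝ} (hT : t₀ ≤ T) :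
    (∫ x in (1 / 2 : ℝ)..2, logDerivFactor e α β (x + t₀ * I)).im
        - (∫ x in (1 / 2 : ℝ)..2, logDerivFactor e α β (x + T * I)).im
        + (∫ y in t₀..T, logDerivFactor e α β ((2 : ℝ) + y * I)).re
      = e * (T - t₀) + (∫ u in 0..α * T, digamma ((α / 2 + β : ℝ) + u * I)).re
        - (∫ u in 0..α * t₀, digamma ((α / 2 + β : ℝ) + u * I)).re := by
  have hb : 0 < α / 2 + β := by linarith [h.pos, h.nonneg]
  have h0 := rectIntegral_eq_zero (F := logDerivFactor e α β) (a := 1 / 2) (b := 2)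
    (by norm_num) hT (h.differentiableOn_logDerivFactor.mono fun s hs =>
      lt_of_lt_of_le (by norm_num) hs.1.1)
  have h1 := congrArg im h0
  rw [rectIntegral] at h1
  simp only [sub_im, add_im, I_mul_im, zero_im] at h1
  have hψ := continuous_digamma_vertical hb
  have h2 : (∫ y in t₀..T, logDerivFactor e α β ((1 / 2 : ℝ) + y * I))
      = e * (T - t₀ : ℝ) + ((∫ u in 0..α * T, digamma ((α / 2 + β : ℝ) + u * I))
        - ∫ u in 0..α * t₀, digamma ((α / 2 + β : ℝ) + u * I)) := by
    have h3 : ∀ y : ℝ, logDerivFactor e α β ((1 / 2 : ℝ) + y * I)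
        = e + α * digamma ((α / 2 + β : ℝ) + (α * y : ℝ) * I) := fun y => by
      rw [logDerivFactor]
      congr 3
      push_cast
      ring
    simp only [h3]
    rw [intervalIntegral.integral_add intervalIntegrable_const
      (Continuous.intervalIntegrable (u := fun y : ℝ => α * digamma ((α / 2 + β : ℝ) + (α * y : ℝ) * I))
        (continuous_const.mul (hψ.comp (continuous_const.mul continuous_id))) _ _), intervalIntegral.integral_const,
      intervalIntegral.integral_const_mul, intervalIntegral.integral_interval_sub_left
        (hψ.intervalIntegrable _ _) (hψ.intervalIntegrable _ _),
      ← intervalIntegral.smul_integral_comp_mul_left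
        (fun u : ℝ => digamma ((α / 2 + β : ℝ) + u * I)) α, real_smul, real_smul]
    ring
  rw [h2] at h1
  rw [add_re, re_ofReal_mul, ofReal_re, sub_re] at h1
  linarith

/-- Λ'/Λ splits into the explicit factor, which yields the main term, and f'/f, which yields the
error. -/
theorem pi_mul_count_eq' (h : IsCompletion Λ f e α β) {t₀ T : ℝ} (ht₀ : 0 < t₀) (hT : t₀ < T)
    (h1 : ∀ s : ℂ, s.im = t₀ → Λ s ≠ 0) (h2 : ∀ s : ℂ, s.im = T → Λ s ≠ 0) :
    Real.pi * (∑ᶠ u ∈ closedRect (-1) 2 t₀ T, zeroMultiplicity Λ u : ℕ)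
      = e * (T - t₀) + (∫ u in 0..α * T, digamma ((α / 2 + β : ℝ) + u * I)).re
        - (∫ u in 0..α * t₀, digamma ((α / 2 + β : ℝ) + u * I)).re
        + (∫ x in (1 / 2 : ℝ)..2, logDeriv f (x + t₀ * I)).im
        - (∫ x in (1 / 2 : ℝ)..2, logDeriv f (x + T * I)).im
        + (∫ y in t₀..T, logDeriv f ((2 : ℝ) + y * I)).re := by
  have hhor : ∀ y : ℝ, 0 < y → (∀ s : ℂ, s.im = y → Λ s ≠ 0) →
      ∫ x in (1 / 2 : ℝ)..2, logDeriv Λ (x + y * I)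
        = (∫ x in (1 / 2 : ℝ)..2, logDerivFactor e α β (x + y * I))
          + ∫ x in (1 / 2 : ℝ)..2, logDeriv f (x + y * I) := by
    intro y hy h0
    have hle : (1 / 2 : ℝ) ≤ 2 := by norm_num
    have hs : ∀ s ∈ {s : ℂ | s.im = y ∧ 0 < s.re}, f s ≠ 0 ∧ 0 < s.im := fun s hs =>
      have him : 0 < s.im := by rw [hs.1]; exact hy
      ⟨(h.eq_zero_iff him hs.2).not.1 (h0 s hs.1), him⟩
    have hmem : ∀ x ∈ Icc (1 / 2 : ℝ) 2, (x + y * I : ℂ) ∈ {s : ℂ | s.im = y ∧ 0 < s.re} :=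
      fun x hx => ⟨by simp, by simpa using lt_of_lt_of_le (by norm_num) hx.1⟩
    rw [← intervalIntegral.integral_add
      ((h.differentiableOn_logDerivFactor.continuousOn).intervalIntegrable_horizontal hle
        fun x hx => (hmem x hx).2)
      (ContinuousOn.intervalIntegrable_horizontal (s := {s : ℂ | s.im = y ∧ 0 < s.re}) hle
        (fun s h' => (h.continuousAt_logDeriv (hs s h').2 (hs s h').1).continuousWithinAt) hmem)]
    refine intervalIntegral.integral_congr fun x hx => ?_
    rw [uIcc_of_le hle] at hx
    have := hmem x hx
    exact h.logDeriv_eq (hs _ this).2 this.2 (hs _ this).1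
  have hver : ∫ y in t₀..T, logDeriv Λ ((2 : ℝ) + y * I)
      = (∫ y in t₀..T, logDerivFactor e α β ((2 : ℝ) + y * I))
        + ∫ y in t₀..T, logDeriv f ((2 : ℝ) + y * I) := by
    have hs : ∀ s ∈ {s : ℂ | s.re = 2 ∧ 0 < s.im}, f s ≠ 0 := fun s hs =>
      h.ne_zero s hs.2 (by rw [hs.1]; norm_num)
    have hmem : ∀ y ∈ Icc t₀ T, ((2 : ℝ) + y * I : ℂ) ∈ {s : ℂ | s.re = 2 ∧ 0 < s.im} :=
      fun y hy => ⟨by simp, by simpa using lt_of_lt_of_le ht₀ hy.1⟩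
    rw [← intervalIntegral.integral_add
      ((h.differentiableOn_logDerivFactor.continuousOn).intervalIntegrable_vertical hT.le
        fun y _ => by simp)
      (ContinuousOn.intervalIntegrable_vertical (s := {s : ℂ | s.re = 2 ∧ 0 < s.im}) hT.le
        (fun s h' => (h.continuousAt_logDeriv h'.2 (hs s h')).continuousWithinAt) hmem)]
    refine intervalIntegral.integral_congr fun y hy => ?_
    rw [uIcc_of_le hT.le] at hy
    have := hmem y hy
    exact h.logDeriv_eq this.2 (by simp) (hs _ this)
  rw [h.pi_mul_count_eq ht₀ hT h1 h2, hhor t₀ ht₀ h1, hhor T (ht₀.trans hT) h2, hver, add_im,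
    add_im, add_re, ← h.re_integral_logDerivFactor hT.le]
  ring

/-- Backlund's bound in discs about 2+iT: radius 3/2 reaches ½+iT, and 3/2 < 7/4 < 15/8 < 2 keeps
the largest disc inside re s ≥ 1/8. The bound M = C(2T)^k accounts for log T. -/
theorem exists_abs_im_integral_le (h : IsCompletion Λ f e α β) :
    ∃ A B : ℝ, 0 ≤ B ∧ ∀ T : ℝ, 4 ≤ T → (∀ s : ℂ, s.im = T → Λ s ≠ 0) →
      |(∫ x in (1 / 2 : ℝ)..2, logDeriv f (x + T * I)).im| ≤ A + B * Real.log T := by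
  obtain ⟨C, k, hC, hb⟩ := h.bound
  obtain ⟨m, hm, hl⟩ := h.lower
  set K : ℝ := 2 * Real.pi / Real.log ((15 / 8) / (7 / 4)) + 2 * (3 / 2) / (7 / 4 - 3 / 2) with hK
  have hK0 : 0 ≤ K := by
    have : 0 < Real.log ((15 / 8) / (7 / 4)) := Real.log_pos (by norm_num)
    have := Real.pi_pos
    rw [hK]
    positivity
  refine ⟨K * (Real.log (C / m) + k * Real.log 2 + 1), K * k, by positivity, fun T hT h0 => ?_⟩
  have hT0 : 0 < T := by linarith
  have hball : ∀ z ∈ Metric.closedBall (2 + T * I : ℂ) (15 / 8),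
      1 / 8 ≤ z.re ∧ z.re ≤ 4 ∧ 1 ≤ z.im ∧ z.im ≤ 2 * T := fun z hz => by
    rw [Metric.mem_closedBall, dist_eq_norm] at hz
    have h1 := abs_le.1 ((abs_re_le_norm _).trans hz)
    have h2 := abs_le.1 ((abs_im_le_norm _).trans hz)
    simp at h1 h2
    refine ⟨?_, ?_, ?_, ?_⟩ <;> linarith
  have hmain := abs_im_integral_logDeriv_le (f := f) (c := 2 + T * I) (r := 3 / 2) (r₁ := 7 / 4)
    (R := 15 / 8) (M := C * (2 * T) ^ k) (by norm_num) (by norm_num) (by norm_num) hm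
    (fun z hz => h.differentiableOn.analyticAt
      (isOpen_im_pos.mem_nhds (lt_of_lt_of_le one_pos (hball z hz).2.2.1)))
    (fun z hz => by
      obtain ⟨h1, h2, h3, h4⟩ := hball z hz
      refine (hb z h1 h2 h3).trans ?_
      gcongr)
    (hl T hT0) (fun x hx => by
      simp at hx
      simp only [add_im, im_ofNat, mul_im, ofReal_re, I_im, mul_one, ofReal_im, I_re, mul_zero,
        add_zero, zero_add]
      refine (h.eq_zero_iff (by simpa using hT0) ?_).not.1 (h0 _ (by simp))
      simp
      linarith [hx.1])
  have hre : (2 + T * I : ℂ).re = 2 := by simp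
  have himT : (2 + T * I : ℂ).im = T := by simp
  rw [hre, himT, show (2 : ℝ) - 3 / 2 = 1 / 2 by norm_num] at hmain
  have hlog : Real.log (C * (2 * T) ^ k / m)
      = Real.log (C / m) + k * (Real.log 2 + Real.log T) := by
    rw [mul_div_right_comm, Real.log_mul (by positivity) (by positivity), Real.log_pow,
      Real.log_mul (by norm_num) hT0.ne']
  refine hmain.trans (le_of_eq ?_)
  rw [hlog]
  ring

/-- Zeros with im s > 0 have 0 ≤ re s ≤ 1, so widening the rectangle adds none, and no zero on im s
= t₀ is counted twice. The real axis, with its possible poles, only affects the fixed count up to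
t₀. -/
theorem zeroCount_eq_add (h : IsCompletion Λ f e α β) {t₀ T : ℝ} (ht₀ : 0 < t₀) (hT : t₀ ≤ T)
    (h1 : ∀ s : ℂ, s.im = t₀ → Λ s ≠ 0) :
    zeroCount Λ T = zeroCount Λ t₀ + ∑ᶠ u ∈ closedRect (-1) 2 t₀ T, zeroMultiplicity Λ u := by
  set S : Set ℂ := {s ∈ criticalRectangle T | t₀ < s.im} with hS
  have hunion : criticalRectangle T = criticalRectangle t₀ ∪ S := by
    ext s
    simp only [hS, criticalRectangle, mem_union, mem_ofPred_eq]
    constructor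
    · rintro ⟨h1, h2, h3, h4⟩
      rcases le_or_gt s.im t₀ with h5 | h5
      · exact Or.inl ⟨h1, h2, h3, h5⟩
      · exact Or.inr ⟨⟨h1, h2, h3, h4⟩, h5⟩
    · rintro (⟨h1, h2, h3, h4⟩ | ⟨h, -⟩)
      · exact ⟨h1, h2, h3, h4.trans hT⟩
      · exact h
  have hdisj : Disjoint (criticalRectangle t₀) S :=
    Set.disjoint_left.2 fun s hs hs' => not_lt.2 hs.2.2.2 hs'.2
  have hfin : ∀ U, (criticalRectangle U ∩ Function.support (zeroMultiplicity Λ)).Finite := fun U =>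
    (finite_zeroMultiplicity_pos h.meromorphicAt (isCompact_criticalRectangle U)).subset
      fun s hs => ⟨hs.1, Nat.pos_of_ne_zero hs.2⟩
  rw [zeroCount, hunion, finsum_mem_union' hdisj (hfin t₀)
    ((hfin T).subset (inter_subset_inter_left _ fun s hs => hs.1)), zeroCount]
  congr 1
  refine finsum_mem_inter_support_eq _ _ _ ?_
  ext s
  simp only [mem_inter_iff, Function.mem_support]
  refine and_congr_left fun hs0 => ?_
  constructor
  · rintro ⟨⟨h3, h4, h5, h6⟩, h7⟩
    exact mem_closedRect.2 ⟨⟨by linarith, by linarith⟩, h7.le, h6⟩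
  · intro hs
    have him : 0 < s.im := ht₀.trans_le hs.2.1
    have hz := (h.zeroMultiplicity_pos_iff him).1 (Nat.pos_of_ne_zero hs0)
    have hre := h.re_mem_of_eq_zero him hz
    exact ⟨⟨hre.1, hre.2, him.le, hs.2.2⟩, lt_of_le_of_ne hs.2.1 fun h' => h1 s h'.symm hz⟩

/-- Slightly above a given height there are no zeros, and the number of zeros does not change. -/
theorem eventually_ne_zero (h : IsCompletion Λ f e α β) {T : ℝ} (hT : 0 < T) :
    ∀ᶠ T' in 𝓝[>] T, (∀ s : ℂ, s.im = T' → Λ s ≠ 0) ∧ zeroCount Λ T' = zeroCount Λ T := by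
  set Z := {s ∈ criticalRectangle (T + 1) | 0 < zeroMultiplicity Λ s} with hZ
  have hZfin : Z.Finite :=
    finite_zeroMultiplicity_pos h.meromorphicAt (isCompact_criticalRectangle (T + 1))
  have h1 : ∀ᶠ T' in 𝓝[>] T, ∀ z ∈ Z, T < z.im → T' < z.im := by
    rw [eventually_all_finite hZfin]
    intro z _
    by_cases hz : T < z.im
    · filter_upwards [nhdsWithin_le_nhds (Iio_mem_nhds hz)] with T' hT' _ using hT'
    · exact Eventually.of_forall fun _ h' => absurd h' hz
  have h2 : ∀ᶠ T' in 𝓝[>] T, T' < T + 1 :=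
    nhdsWithin_le_nhds (Iio_mem_nhds (by linarith))
  filter_upwards [h1, h2, self_mem_nhdsWithin] with T' h1 h2 (h3 : T < T')
  constructor
  · intro s hs h0
    have him : 0 < s.im := by linarith
    have hre := h.re_mem_of_eq_zero him h0
    have := h1 s ⟨⟨hre.1, hre.2, him.le, by linarith⟩, (h.zeroMultiplicity_pos_iff him).2 h0⟩
      (by linarith)
    linarith
  · refine finsum_mem_inter_support_eq _ _ _ ?_
    ext s
    simp only [mem_inter_iff, Function.mem_support]
    refine and_congr_left fun hs0 => ⟨fun hs => ⟨hs.1, hs.2.1, hs.2.2.1, ?_⟩,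
      fun hs => ⟨hs.1, hs.2.1, hs.2.2.1, hs.2.2.2.trans h3.le⟩⟩
    by_contra hlt
    have := h1 s ⟨⟨hs.1, hs.2.1, hs.2.2.1, hs.2.2.2.trans h2.le⟩, Nat.pos_of_ne_zero hs0⟩
      (by linarith)
    linarith [hs.2.2.2]

/-- The Riemann–von Mangoldt formula. -/
theorem zeroCount_isBigO (h : IsCompletion Λ f e α β) :
    (fun T : ℝ => (zeroCount Λ T : ℝ) - T / Real.pi * (e + α * Real.log (α * T) - α))
      =O[atTop] Real.log := by
  obtain ⟨t₀, ⟨ht₀, ht₀2⟩, ht₀1⟩ : ∃ t₀, t₀ ∈ Ioo (1 : ℝ) 2 ∧ ∀ s : ℂ, s.im = t₀ → Λ s ≠ 0 := by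
    obtain ⟨t₀, h1, h2⟩ := ((h.eventually_ne_zero one_pos).and
      (Ioo_mem_nhdsGT (show (1 : ℝ) < 2 by norm_num))).exists
    exact ⟨t₀, h2, h1.1⟩
  have ht₀0 : 0 < t₀ := by linarith
  obtain ⟨A, B, hB, hAB⟩ := h.exists_abs_im_integral_le
  obtain ⟨C, hC⟩ := h.arg
  have hα := h.pos
  have hb : 0 < α / 2 + β := by linarith [h.nonneg]
  -- `D` collects what depends on t₀ alone.
  set D := |Real.pi * zeroCount Λ t₀ - e * t₀
    - (∫ u in 0..α * t₀, digamma ((α / 2 + β : ℝ) + u * I)).re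
    + (∫ x in (1 / 2 : ℝ)..2, logDeriv f (x + t₀ * I)).im| with hD
  set E := Real.pi / 2 + (α / 2 + β) * (Real.pi / 2) + (α / 2 + β) ^ 2 / 2 with hE
  set main : ℝ → ℝ := fun T => T * (e + α * Real.log (α * T) - α) with hmain
  -- T ≥ 4 is needed for Backlund's discs, and T ≥ 1/α makes αT ≥ 1 for Stirling's formula.
  have hgood : ∀ T : ℝ, 4 + 1 / α ≤ T → (∀ s : ℂ, s.im = T → Λ s ≠ 0) →
      |Real.pi * zeroCount Λ T - main T| ≤ D + E + C + A + B * Real.log T := by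
    intro T hT h0
    have hα' : 0 < 1 / α := by positivity
    have hT4 : 4 ≤ T := by linarith
    have hαT : 1 ≤ α * T := by
      have : 1 / α ≤ T := by linarith
      rwa [div_le_iff₀' hα] at this
    have h2 : t₀ < T := by linarith
    have hcount := h.pi_mul_count_eq' ht₀0 h2 ht₀1 h0
    have hstir := abs_le.1 (abs_re_integral_digamma_sub_le hb hαT)
    have hJ := abs_le.1 (hAB T hT4 h0)
    have hV := abs_le.1 (hC t₀ T ht₀0 h2.le)
    have hDD := abs_le.1 (le_of_eq hD.symm)
    rw [h.zeroCount_eq_add ht₀0 h2.le ht₀1, Nat.cast_add, mul_add, hcount, hmain]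
    simp only
    have hring : T * (e + α * Real.log (α * T) - α)
        = e * T + (α * T * Real.log (α * T) - α * T) := by ring
    rw [hring, abs_le]
    constructor <;> linarith [hstir.1, hstir.2, hJ.1, hJ.2, hV.1, hV.2, hDD.1, hDD.2]
  -- For arbitrary T, let good heights T' decrease to T: the count does not change and both other
  -- terms are continuous.
  have hall : ∀ T : ℝ, 4 + 1 / α ≤ T →
      |Real.pi * zeroCount Λ T - main T| ≤ D + E + C + A + B * Real.log T := by
    intro T hT
    have hT0 : 0 < T := by
      have : 0 < 1 / α := by positivity
      linarith
    have hcont : ContinuousAt main T := by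
      have : α * T ≠ 0 := by positivity
      exact continuousAt_id.mul ((continuousAt_const.add (continuousAt_const.mul
        ((continuousAt_const.mul continuousAt_id).log this))).sub continuousAt_const)
    have hl : Tendsto (fun T' => |Real.pi * zeroCount Λ T - main T'|) (𝓝[>] T)
        (𝓝 |Real.pi * zeroCount Λ T - main T|) :=
      ((tendsto_const_nhds.sub (hcont.tendsto.mono_left nhdsWithin_le_nhds)).abs)
    have hr : Tendsto (fun T' => D + E + C + A + B * Real.log T') (𝓝[>] T)
        (𝓝 (D + E + C + A + B * Real.log T)) :=
      (((Real.continuousAt_log hT0.ne').tendsto.mono_left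
        nhdsWithin_le_nhds).const_mul B).const_add _
    refine le_of_tendsto_of_tendsto hl hr ?_
    filter_upwards [h.eventually_ne_zero hT0, self_mem_nhdsWithin] with T' h1 (h2 : T < T')
    rw [← h1.2]
    exact hgood T' (by linarith) h1.1
  refine Asymptotics.IsBigO.of_bound ((|D + E + C + A| + B) / Real.pi) ?_
  filter_upwards [eventually_ge_atTop (4 + 1 / α), eventually_ge_atTop (Real.exp 1)] with T h1 h2
  have hlog : 1 ≤ Real.log T := by
    rw [Real.le_log_iff_exp_le (lt_of_lt_of_le (Real.exp_pos 1) h2)]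
    exact h2
  have hpi := Real.pi_pos
  have h3 : (zeroCount Λ T : ℝ) - T / Real.pi * (e + α * Real.log (α * T) - α)
      = (Real.pi * zeroCount Λ T - main T) / Real.pi := by
    rw [hmain]
    field_simp
  rw [h3, norm_div, Real.norm_eq_abs, Real.norm_of_nonneg hpi.le,
    Real.norm_of_nonneg (by linarith : 0 ≤ Real.log T), div_mul_eq_mul_div]
  gcongr
  refine (hall T h1).trans ?_
  nlinarith [le_abs_self (D + E + C + A), abs_nonneg (D + E + C + A)]

end IsCompletion

/-! ### The character modulo 4, functional equations and meromorphy. -/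

/-- The nontrivial Dirichlet character modulo `4`, with complex values. -/
noncomputable abbrev chiFour : DirichletCharacter ℂ 4 :=
  ZMod.χ₄.ringHomComp (Int.castRingHom ℂ)

theorem chiFour_natCast (n : ℕ) :
    chiFour n = if n % 2 = 0 then 0 else if n % 4 = 1 then 1 else -1 := by
  rw [MulChar.ringHomComp_apply, ZMod.χ₄_nat_eq_if_mod_four]
  split_ifs <;> simp

theorem chiFour_odd : chiFour.Odd := by
  rw [DirichletCharacter.Odd, MulChar.ringHomComp_apply]
  have : ZMod.χ₄ (-1) = -1 := by decide
  simp [this]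

theorem chiFour_ne_one : chiFour ≠ 1 := by
  intro h
  have h1 : chiFour (-1) = -1 := chiFour_odd
  rw [h, MulChar.one_apply (by simp)] at h1
  norm_num at h1

theorem chiFour_inv : chiFour⁻¹ = chiFour := by
  rw [MulChar.IsQuadratic.inv]
  exact ZMod.isQuadratic_χ₄.comp _

/-- Otherwise the conductor divides 2 and the character is trivial on all units, as (ℤ/2)ˣ is
trivial; but its value at -1 is -1. -/
theorem chiFour_isPrimitive : chiFour.IsPrimitive := by
  rw [DirichletCharacter.isPrimitive_def]
  by_contra hne
  have hdvd := DirichletCharacter.conductor_dvd_level chiFour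
  have h2 : chiFour.conductor ∣ 2 := by
    have hle := Nat.le_of_dvd (by norm_num) hdvd
    interval_cases chiFour.conductor <;> revert hdvd hne <;> decide
  have hf := DirichletCharacter.FactorsThrough.mono _
    (DirichletCharacter.factorsThrough_conductor chiFour) h2 (by norm_num : 2 ∣ 4)
  rw [DirichletCharacter.factorsThrough_iff_ker_unitsMap (by norm_num)] at hf
  have hk : (-1 : (ZMod 4)ˣ) ∈ (ZMod.unitsMap (by norm_num : 2 ∣ 4)).ker := by
    rw [MonoidHom.mem_ker]
    exact Subsingleton.elim _ _
  have := hf hk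
  rw [MonoidHom.mem_ker, chiFour_odd.toUnitHom_eval_neg_one] at this
  have h3 := congrArg Units.val this
  norm_num at h3

theorem sum_chiFour (n : ℕ) :
    ∑ k ∈ Finset.Icc 1 n, chiFour k = if n % 4 = 1 ∨ n % 4 = 2 then 1 else 0 := by
  induction n with
  | zero => simp
  | succ n ih =>
    rw [Finset.sum_Icc_succ_top (by omega), ih, chiFour_natCast]
    have : n % 4 = 0 ∨ n % 4 = 1 ∨ n % 4 = 2 ∨ n % 4 = 3 := by omega
    rcases this with h | h | h | h
    · rw [if_neg (by omega), if_neg (by omega), if_pos (by omega), if_pos (by omega)]; norm_num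
    · rw [if_pos (by omega), if_pos (by omega), if_pos (by omega)]; norm_num
    · rw [if_pos (by omega), if_neg (by omega), if_neg (by omega), if_neg (by omega)]; norm_num
    · rw [if_neg (by omega), if_pos (by omega), if_neg (by omega)]; norm_num

theorem norm_sum_chiFour_le (n : ℕ) : ‖∑ k ∈ Finset.Icc 1 n, chiFour k‖ ≤ 1 := by
  rw [sum_chiFour]
  split_ifs <;> simp

theorem differentiable_dirichletBeta : Differentiable ℂ dirichletBeta :=
  DirichletCharacter.differentiable_LFunction chiFour_ne_one

theorem dirichletBeta_eq_LSeries {s : ℂ} (hs : 1 < s.re) :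
    dirichletBeta s = LSeries (fun n => chiFour n) s :=
  DirichletCharacter.LFunction_eq_LSeries _ hs

/-- The coefficients are real, so the identity holds for re s > 1 and extends by the identity
theorem. -/
theorem dirichletBeta_conj (s : ℂ) :
    dirichletBeta ((starRingEnd ℂ) s) = (starRingEnd ℂ) (dirichletBeta s) := by
  have hg : Differentiable ℂ fun z => (starRingEnd ℂ) (dirichletBeta ((starRingEnd ℂ) z)) :=
    fun z => differentiableAt_conj_conj_iff.mpr (differentiable_dirichletBeta _)
  have hgz (z : ℂ) (hz : 1 < z.re) :
      (starRingEnd ℂ) (dirichletBeta ((starRingEnd ℂ) z)) = dirichletBeta z := by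
    rw [dirichletBeta_eq_LSeries (by rwa [conj_re]), dirichletBeta_eq_LSeries hz, LSeries,
      conj_tsum, LSeries]
    refine tsum_congr fun n => ?_
    rcases eq_or_ne n 0 with rfl | hn
    · simp
    · rw [LSeries.term_of_ne_zero hn, LSeries.term_of_ne_zero hn, map_div₀,
        ← conj_cpow _ _ (by rw [natCast_arg]; positivity), conj_natCast, chiFour_natCast]
      congr 1
      split_ifs <;> simp
  have heq := (analyticOnNhd_univ_iff_differentiable.mpr hg).eqOn_of_preconnected_of_eventuallyEq
    (analyticOnNhd_univ_iff_differentiable.mpr differentiable_dirichletBeta)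
    isPreconnected_univ (mem_univ 2)
    (eventuallyEq_of_mem ((isOpen_lt continuous_const continuous_re).mem_nhds (by simp)) hgz)
  simpa using congrArg (starRingEnd ℂ) (heq (mem_univ s))

theorem completedLFunction_chiFour_one_sub (s : ℂ) :
    DirichletCharacter.completedLFunction chiFour (1 - s) =
      exp (2 * Real.log 2 * (s - 1 / 2)) * DirichletCharacter.rootNumber chiFour *
        DirichletCharacter.completedLFunction chiFour s := by
  rw [chiFour_isPrimitive.completedLFunction_one_sub, chiFour_inv]
  congr 2
  rw [cpow_def_of_ne_zero (by norm_num), show ((4 : ℕ) : ℂ) = ((4 : ℝ) : ℂ) by norm_num,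
    ← ofReal_log (by norm_num), show (4 : ℝ) = 2 ^ 2 by norm_num, Real.log_pow]
  push_cast
  rfl

theorem Gammaℝ_ne_zero_of_im_ne_zero {s : ℂ} (hs : s.im ≠ 0) : Gammaℝ s ≠ 0 := by
  rw [Ne, Gammaℝ_eq_zero_iff]
  rintro ⟨n, hn⟩
  apply hs
  rw [hn]
  simp

theorem ofReal_cpow_eq_exp {x : ℝ} (hx : 0 < x) (s : ℂ) : (x : ℂ) ^ s = exp (Real.log x * s) := by
  rw [cpow_def_of_ne_zero (by exact_mod_cast hx.ne'), ofReal_log hx.le]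

theorem completedLFunction_chiFour_eq {s : ℂ} (hs : s.im ≠ 0) :
    DirichletCharacter.completedLFunction chiFour s = Gammaℝ (s + 1) * dirichletBeta s := by
  rw [dirichletBeta, DirichletCharacter.LFunction_eq_completed_div_gammaFactor _ _ (by norm_num),
    chiFour_odd.gammaFactor_def, mul_div_cancel₀]
  exact Gammaℝ_ne_zero_of_im_ne_zero (by simpa using hs)

/-- The completion of `dirichletBeta`, normalised to have a factor `exp (e * s)` with `e` real. -/
noncomputable def completedBeta (s : ℂ) : ℂ :=
  exp (((1 / 2 * Real.log (4 / Real.pi) : ℝ) : ℂ) * s) * Gamma (((1 / 2 : ℝ) : ℂ) * s +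
    ((1 / 2 : ℝ) : ℂ)) * dirichletBeta s

/-- The factor 2^s is the point: 2^(1-s) · 4^(s-1/2) = 2^s removes the conductor from the functional
equation. -/
theorem completedBeta_eq {s : ℂ} (hs : s.im ≠ 0) :
    completedBeta s = exp (Real.log Real.pi / 2) * exp (Real.log 2 * s) *
      DirichletCharacter.completedLFunction chiFour s := by
  rw [completedLFunction_chiFour_eq hs, completedBeta, Gammaℝ_def,
    ofReal_cpow_eq_exp Real.pi_pos,
    show ((1 / 2 : ℝ) : ℂ) * s + ((1 / 2 : ℝ) : ℂ) = (s + 1) / 2 by push_cast; ring,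
    ← mul_assoc, ← mul_assoc, ← exp_add, ← exp_add,
    Real.log_div (by norm_num) Real.pi_ne_zero, show (4 : ℝ) = 2 ^ 2 by norm_num, Real.log_pow]
  congr 3
  push_cast
  ring

theorem completedBeta_one_sub {s : ℂ} (hs : s.im ≠ 0) :
    completedBeta (1 - s) = DirichletCharacter.rootNumber chiFour * completedBeta s := by
  rw [completedBeta_eq hs, completedBeta_eq (by simpa using hs),
    completedLFunction_chiFour_one_sub]
  have : exp ((Real.log 2 : ℂ) * s) =
      exp (Real.log 2 * (1 - s)) * exp (2 * Real.log 2 * (s - 1 / 2)) := by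
    rw [← exp_add]; ring_nf
  rw [this]
  ring

theorem completedBeta_conj (s : ℂ) :
    completedBeta ((starRingEnd ℂ) s) = (starRingEnd ℂ) (completedBeta s) := by
  simp only [completedBeta, map_mul, ← exp_conj, ← Gamma_conj, map_add, conj_ofReal,
    dirichletBeta_conj]

theorem functionA_eq_exp (s : ℂ) :
    functionA s = exp (((-Real.log Real.pi : ℝ) : ℂ) * s) * Gamma s *
      (riemannZeta s * dirichletBeta s) := by
  rw [functionA, ofReal_cpow_eq_exp Real.pi_pos, div_eq_mul_inv, ← exp_neg, ofReal_neg, neg_mul]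
  ring

/-- By duplication `Gammaℝ s * Gammaℝ (s + 1)` is 2(2π)^(-s) Γ(s), so A is, up to ½ · 2^s, the
product of the two completed functions. Off the real axis no Gamma factor has a pole. -/
theorem functionA_eq {s : ℂ} (hs : s.im ≠ 0) :
    functionA s = 1 / 2 * exp (Real.log 2 * s) * completedRiemannZeta s *
      DirichletCharacter.completedLFunction chiFour s := by
  have h0 : s ≠ 0 := by rintro rfl; simp at hs
  have hΓ : Gammaℝ s ≠ 0 := Gammaℝ_ne_zero_of_im_ne_zero hs
  have hζ : completedRiemannZeta s = Gammaℝ s * riemannZeta s := by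
    rw [riemannZeta_def_of_ne_zero h0, mul_div_cancel₀ _ hΓ]
  have hG : Gammaℝ s * Gammaℝ (s + 1) = 2 * (exp (-(Real.log 2 * s)) *
      exp (((-Real.log Real.pi : ℝ) : ℂ) * s)) * Gamma s := by
    rw [Gammaℝ_mul_Gammaℝ_add_one, Gammaℂ_def,
      show (2 * (Real.pi : ℂ)) = ((2 * Real.pi : ℝ) : ℂ) by push_cast; rfl,
      ofReal_cpow_eq_exp (by positivity), Real.log_mul (by norm_num) Real.pi_ne_zero, ← exp_add]
    congr 3
    push_cast
    ring
  calc functionA s = (exp (Real.log 2 * s) * exp (-(Real.log 2 * s))) * functionA s := by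
        rw [← exp_add]; simp
    _ = 1 / 2 * exp (Real.log 2 * s) * (Gammaℝ s * Gammaℝ (s + 1)) *
        (riemannZeta s * dirichletBeta s) := by
        rw [hG, functionA_eq_exp]; ring
    _ = _ := by rw [hζ, completedLFunction_chiFour_eq hs]; ring

theorem functionA_one_sub {s : ℂ} (hs : s.im ≠ 0) :
    functionA (1 - s) = DirichletCharacter.rootNumber chiFour * functionA s := by
  rw [functionA_eq hs, functionA_eq (by simpa using hs),
    completedLFunction_chiFour_one_sub, completedRiemannZeta_one_sub]
  have : exp ((Real.log 2 : ℂ) * s) =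
      exp (Real.log 2 * (1 - s)) * exp (2 * Real.log 2 * (s - 1 / 2)) := by
    rw [← exp_add]; ring_nf
  rw [this]
  ring

theorem functionA_conj (s : ℂ) :
    functionA ((starRingEnd ℂ) s) = (starRingEnd ℂ) (functionA s) := by
  simp only [functionA_eq_exp, map_mul, ← exp_conj, ← Gamma_conj, conj_ofReal,
    dirichletBeta_conj, riemannZeta_conj]

theorem meromorphicAt_riemannZeta (s : ℂ) : MeromorphicAt riemannZeta s := by
  rcases eq_or_ne s 1 with rfl | hs
  · have hΓ : AnalyticAt ℂ (fun s => (Gammaℝ s)⁻¹) 1 :=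
      (analyticOnNhd_univ_iff_differentiable.mpr differentiable_Gammaℝ_inv) 1 (mem_univ _)
    have h0 : AnalyticAt ℂ completedRiemannZeta₀ 1 :=
      (analyticOnNhd_univ_iff_differentiable.mpr differentiable_completedZeta₀) 1 (mem_univ _)
    have hid : MeromorphicAt (fun s : ℂ => s) 1 := analyticAt_id.meromorphicAt
    have hc : MeromorphicAt (fun _ : ℂ => (1 : ℂ)) 1 := analyticAt_const.meromorphicAt
    refine (((h0.meromorphicAt.sub (hc.div hid)).sub (hc.div (hc.sub hid))).mul
      hΓ.meromorphicAt).congr ?_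
    have : ∀ᶠ s : ℂ in 𝓝 1, s ≠ 0 := isOpen_ne.mem_nhds one_ne_zero
    filter_upwards [nhdsWithin_le_nhds this] with s hs
    rw [riemannZeta_def_of_ne_zero hs, completedRiemannZeta_eq, div_eq_mul_inv]
    rfl
  · exact (analyticOn_riemannZeta s hs).meromorphicAt

theorem analyticAt_dirichletBeta (s : ℂ) : AnalyticAt ℂ dirichletBeta s :=
  (analyticOnNhd_univ_iff_differentiable.mpr differentiable_dirichletBeta) s (mem_univ _)

theorem meromorphicAt_functionA (s : ℂ) : MeromorphicAt functionA s := by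
  rw [funext functionA_eq_exp]
  have he : AnalyticAt ℂ (fun s => exp (((-Real.log Real.pi : ℝ) : ℂ) * s)) s := by fun_prop
  exact (he.meromorphicAt.mul (Meromorphic.Gamma s)).mul
    ((meromorphicAt_riemannZeta s).mul (analyticAt_dirichletBeta s).meromorphicAt)

/-- The reciprocal 1/Γ is entire. -/
theorem meromorphicAt_Gamma_affine (a b : ℝ) (s : ℂ) :
    MeromorphicAt (fun s => Gamma (a * s + b)) s := by
  have : AnalyticAt ℂ (fun s => (Gamma (a * s + b))⁻¹) s := by
    refine (analyticOnNhd_univ_iff_differentiable.mpr ?_) s (mem_univ _)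
    exact differentiable_one_div_Gamma.comp (g := fun s => (Gamma s)⁻¹)
      (f := fun s : ℂ => (a : ℂ) * s + b) (by fun_prop)
  simpa using this.meromorphicAt.fun_inv

theorem meromorphicAt_completedBeta (s : ℂ) : MeromorphicAt completedBeta s := by
  have he : AnalyticAt ℂ
    (fun s => exp (((1 / 2 * Real.log (4 / Real.pi) : ℝ) : ℂ) * s)) s := by fun_prop
  exact (he.meromorphicAt.mul (meromorphicAt_Gamma_affine _ _ s)).mul
    (analyticAt_dirichletBeta s).meromorphicAt

/-! ### Verification of the hypotheses for A and L. -/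

theorem norm_sum_one_sub_le (t : ℝ) (ht : 1 ≤ t) :
    ‖∑ k ∈ Finset.Icc 1 ⌊t⌋₊, (1 : ℕ → ℂ) k - (1 : ℂ) * t‖ ≤ 1 := by
  have h1 := Nat.floor_le (zero_le_one.trans ht)
  have h2 := (Nat.lt_floor_add_one t).le
  have : ∑ k ∈ Finset.Icc 1 ⌊t⌋₊, (1 : ℕ → ℂ) k - (1 : ℂ) * t = ((⌊t⌋₊ - t : ℝ) : ℂ) := by
    simp
  rw [this, norm_real, Real.norm_eq_abs, abs_le]
  constructor <;> linarith

theorem ne_one_of_im_pos {s : ℂ} (hs : 0 < s.im) : s ≠ 1 := by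
  rintro rfl
  simp at hs

theorem differentiableOn_riemannZeta_im_pos :
    DifferentiableOn ℂ riemannZeta {s | 0 < s.im} := fun _ hs =>
  (differentiableAt_riemannZeta (ne_one_of_im_pos hs)).differentiableWithinAt

theorem norm_le_five_mul_im {s : ℂ} (h1 : 0 ≤ s.re) (h2 : s.re ≤ 4) (h3 : 1 ≤ s.im) :
    ‖s‖ ≤ 5 * s.im := by
  have := norm_le_abs_re_add_abs_im s
  rw [abs_of_nonneg h1, abs_of_nonneg (by linarith)] at this
  linarith

/-- Here 45 = 5 · (1 + 8): |s| ≤ 5 im s, 1/|s-1| ≤ 1 and 1/re s ≤ 8. For L the polar term is absent,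
which leaves 40. -/
theorem norm_riemannZeta_le {s : ℂ} (h1 : 1 / 8 ≤ s.re) (h2 : s.re ≤ 4) (h3 : 1 ≤ s.im) :
    ‖riemannZeta s‖ ≤ 45 * s.im := by
  have h := norm_le_of_norm_sum_sub_le (a := 1) (κ := 1) (C := 1)
    differentiableOn_riemannZeta_im_pos
    (fun s hs => (LSeries_one_eq_riemannZeta hs).symm) (by simp)
    norm_sum_one_sub_le (s := s) (by linarith) (by linarith)
  have hs1 : 1 ≤ ‖s - 1‖ := by
    have := (le_abs_self _).trans (abs_im_le_norm (s - 1))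
    simp at this
    linarith
  have h4 : ‖(1 : ℂ)‖ / ‖s - 1‖ ≤ 1 := by
    rw [norm_one]
    exact div_le_one_of_le₀ hs1 (norm_nonneg _)
  have h5 : 1 / s.re ≤ 8 := by
    rw [div_le_iff₀ (by linarith)]; linarith
  calc _ ≤ _ := h
    _ ≤ (5 * s.im) * (1 + 8) := by
      gcongr
      exact norm_le_five_mul_im (by linarith) h2 h3
    _ = _ := by ring

theorem norm_dirichletBeta_le {s : ℂ} (h1 : 1 / 8 ≤ s.re) (h2 : s.re ≤ 4) (h3 : 1 ≤ s.im) :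
    ‖dirichletBeta s‖ ≤ 40 * s.im := by
  have h := norm_le_of_norm_sum_sub_le (a := fun n => chiFour n) (κ := 0) (C := 1)
    differentiable_dirichletBeta.differentiableOn
    (fun s hs => dirichletBeta_eq_LSeries hs) (fun n => chiFour.norm_le_one _)
    (fun t _ => by simpa using norm_sum_chiFour_le ⌊t⌋₊) (s := s) (by linarith) (by linarith)
  have h5 : 1 / s.re ≤ 8 := by
    rw [div_le_iff₀ (by linarith)]; linarith
  calc _ ≤ _ := h
    _ ≤ (5 * s.im) * (0 + 8) := by
      rw [norm_zero, zero_div]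
      gcongr
      exact norm_le_five_mul_im (by linarith) h2 h3
    _ = _ := by ring

theorem norm_riemannZeta_sub_one_le (s : ℂ) (hs : s.re = 2) : ‖riemannZeta s - 1‖ ≤ 2 / 3 := by
  rw [← LSeries_one_eq_riemannZeta (by linarith)]
  exact norm_LSeries_sub_one_le (by simp) (by simp) hs

theorem norm_dirichletBeta_sub_one_le (s : ℂ) (hs : s.re = 2) :
    ‖dirichletBeta s - 1‖ ≤ 2 / 3 := by
  rw [dirichletBeta_eq_LSeries (by linarith)]
  exact norm_LSeries_sub_one_le (fun n => chiFour.norm_le_one _) (by simp) hs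

theorem one_third_le_norm_of_norm_sub_one_le {z : ℂ} (h : ‖z - 1‖ ≤ 2 / 3) : 1 / 3 ≤ ‖z‖ := by
  have h1 : ‖(1 : ℂ)‖ ≤ ‖z‖ + ‖z - 1‖ := by
    simpa using norm_sub_le z (z - 1)
  rw [norm_one] at h1
  linarith

theorem dirichletBeta_ne_zero {s : ℂ} (hs : 1 < s.re) : dirichletBeta s ≠ 0 :=
  DirichletCharacter.LFunction_ne_zero_of_one_le_re _ (Or.inl chiFour_ne_one) hs.le

theorem isCompletion_completedBeta :
    IsCompletion completedBeta dirichletBeta (1 / 2 * Real.log (4 / Real.pi)) (1 / 2) (1 / 2) where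
  pos := by norm_num
  nonneg := by norm_num
  meromorphicAt := meromorphicAt_completedBeta
  eq _ _ := rfl
  differentiableOn := differentiable_dirichletBeta.differentiableOn
  symm := ⟨_, fun s hs => by
    rw [completedBeta_one_sub (by simpa using hs.ne'), completedBeta_conj]⟩
  ne_zero _ _ h := dirichletBeta_ne_zero h
  bound := ⟨40, 1, by norm_num, fun s h1 h2 h3 => by
    simpa using norm_dirichletBeta_le h1 h2 h3⟩
  lower := ⟨1 / 3, by norm_num, fun t _ =>
    one_third_le_norm_of_norm_sub_one_le (norm_dirichletBeta_sub_one_le _ (by simp))⟩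
  arg := ⟨_, fun _ _ h1 h2 => abs_re_integral_logDeriv_le
    differentiable_dirichletBeta.differentiableOn norm_dirichletBeta_sub_one_le h1 h2⟩

theorem continuousOn_logDeriv_vertical {f : ℂ → ℂ} (hf : DifferentiableOn ℂ f {s | 0 < s.im})
    {c t₀ T : ℝ} (h0 : ∀ y : ℝ, 0 < y → f (c + y * I) ≠ 0) (ht₀ : 0 < t₀) (hT : t₀ ≤ T) :
    ContinuousOn (fun y : ℝ => logDeriv f (c + y * I)) (uIcc t₀ T) := by
  have hpos : ∀ y ∈ uIcc t₀ T, 0 < y := fun y hy => by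
    rw [uIcc_of_le hT] at hy
    linarith [hy.1]
  intro y hy
  have hA : AnalyticAt ℂ f (c + y * I) :=
    (hf.analyticOnNhd isOpen_im_pos) _ (by simpa using hpos y hy)
  have hc : ContinuousAt (logDeriv f) (c + y * I) :=
    hA.deriv.continuousAt.div hA.continuousAt (h0 y (hpos y hy))
  exact (ContinuousAt.comp (f := fun y : ℝ => (c : ℂ) + y * I) hc
    (by fun_prop)).continuousWithinAt

theorem isCompletion_functionA :
    IsCompletion functionA (fun s => riemannZeta s * dirichletBeta s) (-Real.log Real.pi) 1 0 where
  pos := by norm_num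
  nonneg := le_rfl
  meromorphicAt := meromorphicAt_functionA
  eq s _ := by simpa using functionA_eq_exp s
  differentiableOn := differentiableOn_riemannZeta_im_pos.mul
    differentiable_dirichletBeta.differentiableOn
  symm := ⟨_, fun s hs => by
    rw [functionA_one_sub (by simpa using hs.ne'), functionA_conj]⟩
  ne_zero _ _ h := mul_ne_zero (riemannZeta_ne_zero_of_one_le_re h.le) (dirichletBeta_ne_zero h)
  bound := ⟨45 * 40, 2, by norm_num, fun s h1 h2 h3 => by
    rw [norm_mul]
    calc _ ≤ (45 * s.im) * (40 * s.im) := mul_le_mul (norm_riemannZeta_le h1 h2 h3)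
          (norm_dirichletBeta_le h1 h2 h3) (norm_nonneg _) (by linarith)
      _ = _ := by ring⟩
  lower := ⟨1 / 3 * (1 / 3), by norm_num, fun t _ => by
    rw [norm_mul]
    exact mul_le_mul
      (one_third_le_norm_of_norm_sub_one_le (norm_riemannZeta_sub_one_le _ (by simp)))
      (one_third_le_norm_of_norm_sub_one_le (norm_dirichletBeta_sub_one_le _ (by simp)))
      (by norm_num) (norm_nonneg _)⟩
  arg := by
    refine ⟨2 * Real.pi + 2 * Real.pi, fun t₀ T h1 h2 => ?_⟩
    have hζ0 : ∀ y : ℝ, 0 < y → riemannZeta ((2 : ℝ) + y * I) ≠ 0 := fun y _ =>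
      riemannZeta_ne_zero_of_one_le_re (by simp)
    have hβ0 : ∀ y : ℝ, 0 < y → dirichletBeta ((2 : ℝ) + y * I) ≠ 0 := fun y _ =>
      dirichletBeta_ne_zero (by simp)
    have hζ := continuousOn_logDeriv_vertical differentiableOn_riemannZeta_im_pos hζ0 h1 h2
    have hβ := continuousOn_logDeriv_vertical
      differentiable_dirichletBeta.differentiableOn hβ0 h1 h2
    have heq : ∫ y in t₀..T, logDeriv (fun s => riemannZeta s * dirichletBeta s)
          ((2 : ℝ) + y * I) =
        (∫ y in t₀..T, logDeriv riemannZeta ((2 : ℝ) + y * I)) +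
          ∫ y in t₀..T, logDeriv dirichletBeta ((2 : ℝ) + y * I) := by
      rw [← intervalIntegral.integral_add hζ.intervalIntegrable hβ.intervalIntegrable]
      refine intervalIntegral.integral_congr fun y hy => ?_
      rw [uIcc_of_le h2] at hy
      have hy0 : 0 < y := h1.trans_le hy.1
      exact logDeriv_mul _ (hζ0 y hy0) (hβ0 y hy0)
        (differentiableAt_riemannZeta (ne_one_of_im_pos (by simpa using hy0)))
        (differentiable_dirichletBeta _)
    rw [heq, add_re]
    exact (abs_add_le _ _).trans (add_le_add
      (abs_re_integral_logDeriv_le differentiableOn_riemannZeta_im_pos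
        norm_riemannZeta_sub_one_le h1 h2)
      (abs_re_integral_logDeriv_le differentiable_dirichletBeta.differentiableOn
        norm_dirichletBeta_sub_one_le h1 h2))

/-- The poles of Γ((s+1)/2) lie at s = -1, -3, …, so for re s ≥ 0 the completing factor is analytic
and nonzero. -/
theorem zeroMultiplicity_completedBeta {s : ℂ} (hs : 0 ≤ s.re) :
    zeroMultiplicity completedBeta s = zeroMultiplicity dirichletBeta s := by
  have hre : 0 < (((1 / 2 : ℝ) : ℂ) * s + ((1 / 2 : ℝ) : ℂ)).re := by
    simp only [add_re, re_ofReal_mul, ofReal_re]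
    linarith
  have hΓ : AnalyticAt ℂ Gamma (((1 / 2 : ℝ) : ℂ) * s + ((1 / 2 : ℝ) : ℂ)) :=
    DifferentiableOn.analyticAt (s := {z | 0 < z.re})
      (fun z hz => (differentiableAt_Gamma_of_re_pos hz).differentiableWithinAt)
      (isOpen_re_pos.mem_nhds hre)
  have hA : AnalyticAt ℂ (fun s => exp (((1 / 2 * Real.log (4 / Real.pi) : ℝ) : ℂ) * s) *
      Gamma (((1 / 2 : ℝ) : ℂ) * s + ((1 / 2 : ℝ) : ℂ))) s := by
    refine AnalyticAt.mul (by fun_prop) ?_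
    exact AnalyticAt.comp (g := Gamma)
      (f := fun s : ℂ => ((1 / 2 : ℝ) : ℂ) * s + ((1 / 2 : ℝ) : ℂ)) hΓ (by fun_prop)
  rw [zeroMultiplicity, zeroMultiplicity]
  congr 2
  exact meromorphicOrderAt_mul_of_ne_zero hA
    (mul_ne_zero (exp_ne_zero _) (Gamma_ne_zero_of_re_pos hre))

theorem zeroCount_completedBeta (T : ℝ) : zeroCount completedBeta T = zeroCount dirichletBeta T :=
  finsum_mem_congr rfl fun _ hs => zeroMultiplicity_completedBeta hs.1

/-! ### The two asymptotic formulas. -/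

theorem mainTheorem5 :
    ((∀ T : ℝ, {s ∈ criticalRectangle T | 0 < zeroMultiplicity functionA s}.Finite) ∧
      (fun T : ℝ => (zeroCount functionA T : ℝ)
          - T / Real.pi * Real.log (T / (Real.pi * Real.exp 1)))
        =O[Filter.atTop] Real.log) ∧
    ((∀ T : ℝ, {s ∈ criticalRectangle T | 0 < zeroMultiplicity dirichletBeta s}.Finite) ∧
      (fun T : ℝ => (zeroCount dirichletBeta T : ℝ)
          - T / (2 * Real.pi) * Real.log (2 * T / (Real.pi * Real.exp 1)))
        =O[Filter.atTop] Real.log) := by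
  have hπ := Real.pi_pos
  refine ⟨⟨fun T => finite_zeroMultiplicity_pos meromorphicAt_functionA
    (isCompact_criticalRectangle T), ?_⟩, ⟨fun T => finite_zeroMultiplicity_pos
    (fun z => (analyticAt_dirichletBeta z).meromorphicAt) (isCompact_criticalRectangle T), ?_⟩⟩
  -- With e = -log π and α = 1 the bracket is log T - log π - 1 = log(T/(πe)), where this last e is
  -- Euler's number.
  · refine isCompletion_functionA.zeroCount_isBigO.congr' ?_ EventuallyEq.rfl
    filter_upwards [eventually_gt_atTop 0] with T hT
    have h : Real.log (T / (Real.pi * Real.exp 1)) = Real.log T - (Real.log Real.pi + 1) := by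
      rw [Real.log_div hT.ne' (by positivity), Real.log_mul hπ.ne' (Real.exp_ne_zero 1),
        Real.log_exp]
    rw [h, one_mul, one_mul]
    ring
  -- With e = ½ log(4/π) and α = ½ the bracket is ½(log(4/π) + log(T/2) - 1), half the logarithm in
  -- the claim.
  · refine isCompletion_completedBeta.zeroCount_isBigO.congr' ?_ EventuallyEq.rfl
    filter_upwards [eventually_gt_atTop 0] with T hT
    have h4 : Real.log (4 / Real.pi) = 2 * Real.log 2 - Real.log Real.pi := by
      rw [Real.log_div (by norm_num) hπ.ne', show (4 : ℝ) = 2 ^ 2 by norm_num, Real.log_pow]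
      norm_num
    have h5 : Real.log (1 / 2 * T) = Real.log T - Real.log 2 := by
      rw [one_div_mul_eq_div, Real.log_div hT.ne' (by norm_num)]
    have h6 : Real.log (2 * T / (Real.pi * Real.exp 1)) =
        Real.log 2 + Real.log T - (Real.log Real.pi + 1) := by
      rw [Real.log_div (by positivity) (by positivity), Real.log_mul (by norm_num) hT.ne',
        Real.log_mul hπ.ne' (Real.exp_ne_zero 1), Real.log_exp]
    rw [zeroCount_completedBeta, h4, h5, h6]
    ring
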